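/- **Integration by parts formula.** Let $T>0$, let $(\Omega,\mathscr F,\mathbb P)$ be a probability space carrying a standard Brownian motion $B$, and let $F(t,s)=f(t)\hat F(t,s)$ for $0\le s\le t\le T$, where $f\neq0$ a.e. on $[0,T]$, $f,\frac1f\in L^2([0,T])$, and $\hat F$ satisfies the following two conditions. * **(A1)** For a.e. $s\in[0,T]$ the function $\hat F(\cdot,s)$ is absolutely continuous on $[s,T]$, and $\frac{\partial \hat F(t,s)}{\partial t}\in L^2(\{0\le s\le t\le T\})$. * **(A4)** $\hat F$ is continuous on $\{0\le s\le t\le T\}$ and there are $\Theta\in L^2([0,T]^2)\cap C^1((0,T)^2)$ and functions $\zeta_1,\zeta_2>0$ on $[0,T]$ with $\zeta_1,\zeta_2,\frac1{\zeta_1},\frac1{\zeta_2}\in L^2([0,T])$ such that, for all $0\le t\le r\le T$, $$\frac{\Theta(r,t)}{\zeta_1(r)}\hat F(r,r)+\int_t^r\frac{\Theta(s,t)}{\zeta_1(s)}\frac{\partial \hat F(r,s)}{\partial r}\,ds=\zeta_2(r),\qquad \frac{\Theta(r,t)}{\zeta_2(t)}\hat F(t,t)+\int_t^r\frac{\partial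 \hat F(s,t)}{\partial s}\frac{\Theta(r,s)}{\zeta_2(s)}\,ds=\zeta_1(t)$$ (the integrands being integrable), and $\frac{\partial\Theta(r,t)}{\partial r}+\frac{\partial\Theta(r,t)}{\partial t}=0$ for $0<t\le r<T$. For a kernel $K$ on $\{0\le s\le t\le T\}$ let $B^K_t=\int_0^tK(t,s)\,dB_s$ $(0\le t\le T)$ in the sense of the Wiener integral. Assume that $B^F$ is (has a version) with values in $W_T=C([0,T];\mathbb R)$, and let $\mu^T$ be its law on $W_T$. Put $$K_Fu(t)=\int_0^tF(t,s)u(s)\,ds,\qquad \mathbb H^F=\{K_Fu: u\in L^2([0,T])\},$$ $$K_{\hat F}^*g(s)=\hat F(s,s)g(s)+\int_s^T\frac{\partial\hat F(t,s)}{\partial t}g(t)\,dt,\qquad R_{\hat F}=K_{\hat F}\circ K_{\hat F}^* .$$ For $\psi\in L^2([0,T])$ let $\int_0^T\psi\,dB^{\hat F}$ denote the $L^2(\mathbb P)$-limit, as the mesh of the partition $0=t_0<\dots<t_n=T$ tends to $0$, of $\sum_i\big(\frac1{t_{i+1}-t_i}\int_{t_i}^{t_{i+1}}\psi(s)\,ds\big)\big(B^{\hat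 F}_{t_{i+1}}-B^{\hat F}_{t_i}\big)$. For $G:W_T\to\mathbb R$ and $k\in W_T$ let $D_kG$ be the limit in $L^2(\mu^T)$ of $\gamma\mapsto\frac{G(\gamma+\varepsilon k)-G(\gamma)}{\varepsilon}$ as $\varepsilon\to0$. Let $h^F\in\mathbb H^F$ (an element of $W_T$), and let $G(\gamma)=g(\gamma(t_1),\dots,\gamma(t_m))$ with $m\ge1$, $0<t_1<\dots<t_m\le T$ and $g:\mathbb R^m\to\mathbb R$ bounded and Lipschitz. Then there is a unique $\psi\in L^2([0,T])$ with $R_{\hat F}\psi=h^F/f$ a.e. on $[0,T]$, denoted $(R_{\hat F})^{-1}\frac{h^F}{f}$; the integral $\beta_{h^F}=\int_0^T(R_{\hat F})^{-1}\frac{h^F}{f}\,dB^{\hat F}$ exists; the derivative $D_{h^F}G$ exists in $L^2(\mu^T)$; and, both sides being integrable, $$\int_\Omega D_{h^F}G(B^F)\,d\mathbb P=\int_\Omega G(B^F)\,\beta_{h^F}\,d\mathbb P .$$ -/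

import Mathlib

open MeasureTheory ProbabilityTheory Filter Topology Set
open scoped NNReal ENNReal

noncomputable section

/-- The path space `W_T = C([0,T]; ℝ)`. -/
abbrev PathSpace (T : ℝ) : Type := C(Icc (0 : ℝ) T, ℝ)

instance pathSpaceMeasurableSpace (T : ℝ) : MeasurableSpace (PathSpace T) :=
  borel (PathSpace T)

instance pathSpaceBorelSpace (T : ℝ) : BorelSpace (PathSpace T) := ⟨rfl⟩

/-- Lebesgue measure on `[0,T]`. -/
abbrev lebesgueOn (T : ℝ) : Measure ℝ := volume.restrict (Icc 0 T)

/-- The closed triangle `{(t,s) : 0 ≤ s ≤ t ≤ T}`, on which a Volterra kernel `F(t,s)` lives. -/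
def kernelTriangle (T : ℝ) : Set (ℝ × ℝ) := {p | 0 ≤ p.2 ∧ p.2 ≤ p.1 ∧ p.1 ≤ T}

/-- The partial derivative `∂F(t,s)/∂t` of the kernel in its first variable `t ∈ [s,T]`
(one-sided at the end points). -/
def kernelDeriv (T : ℝ) (F : ℝ → ℝ → ℝ) (t s : ℝ) : ℝ :=
  derivWithin (fun u => F u s) (Icc s T) t

/-- Condition (A1): `F(·,s)` is absolutely continuous on `[s,T]` for a.e. `s`, and `∂F(t,s)/∂t`
is square integrable. -/
structure CondA1 (T : ℝ) (F : ℝ → ℝ → ℝ) : Prop where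
  absCont : ∀ᵐ s ∂(lebesgueOn T), AbsolutelyContinuousOnInterval (fun t => F t s) s T
  memLp : MemLp (fun p : ℝ × ℝ => kernelDeriv T F p.1 p.2) 2
    (volume.restrict (kernelTriangle T))

/-- The relations that condition (A4) imposes on `Θ`, `ζ₁`, `ζ₂`. -/
structure CondA4Data (T : ℝ) (F Θ : ℝ → ℝ → ℝ) (ζ₁ ζ₂ : ℝ → ℝ) : Prop where
  Θ_memLp : MemLp (fun p : ℝ × ℝ => Θ p.1 p.2) 2 (volume.restrict (Icc 0 T ×ˢ Icc 0 T))
  Θ_contDiff : ContDiffOn ℝ 1 (fun p : ℝ × ℝ => Θ p.1 p.2) (Ioo 0 T ×ˢ Ioo 0 T)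
  ζ₁_pos : ∀ t ∈ Icc 0 T, 0 < ζ₁ t
  ζ₂_pos : ∀ t ∈ Icc 0 T, 0 < ζ₂ t
  ζ₁_memLp : MemLp ζ₁ 2 (lebesgueOn T)
  ζ₂_memLp : MemLp ζ₂ 2 (lebesgueOn T)
  ζ₁_inv_memLp : MemLp (fun t => 1 / ζ₁ t) 2 (lebesgueOn T)
  ζ₂_inv_memLp : MemLp (fun t => 1 / ζ₂ t) 2 (lebesgueOn T)
  eq_one_integrable : ∀ t r, 0 ≤ t → t ≤ r → r ≤ T →
    IntervalIntegrable (fun s => Θ s t / ζ₁ s * kernelDeriv T F r s) volume t r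
  eq_one : ∀ t r, 0 ≤ t → t ≤ r → r ≤ T →
    Θ r t / ζ₁ r * F r r + ∫ s in t..r, Θ s t / ζ₁ s * kernelDeriv T F r s = ζ₂ r
  eq_two_integrable : ∀ t r, 0 ≤ t → t ≤ r → r ≤ T →
    IntervalIntegrable (fun s => kernelDeriv T F s t * (Θ r s / ζ₂ s)) volume t r
  eq_two : ∀ t r, 0 ≤ t → t ≤ r → r ≤ T →
    Θ r t / ζ₂ t * F t t + ∫ s in t..r, kernelDeriv T F s t * (Θ r s / ζ₂ s) = ζ₁ t
  eq_three : ∀ t r, 0 < t → t ≤ r → r < T →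
    deriv (fun x => Θ x t) r + deriv (fun x => Θ r x) t = 0

/-- Condition (A4). -/
def CondA4 (T : ℝ) (F : ℝ → ℝ → ℝ) : Prop :=
  ContinuousOn (fun p : ℝ × ℝ => F p.1 p.2) (kernelTriangle T) ∧
    ∃ (Θ : ℝ → ℝ → ℝ) (ζ₁ ζ₂ : ℝ → ℝ), CondA4Data T F Θ ζ₁ ζ₂

/-- `K_F u (t) = ∫_0^t F(t,s) u(s) ds`. -/
def opK (F : ℝ → ℝ → ℝ) (u : ℝ → ℝ) (t : ℝ) : ℝ := ∫ s in (0 : ℝ)..t, F t s * u s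

/-- `K_F^* g (s) = F(s,s) g(s) + ∫_s^T ∂F(t,s)/∂t g(t) dt`. -/
def opKStar (T : ℝ) (F : ℝ → ℝ → ℝ) (g : ℝ → ℝ) (s : ℝ) : ℝ :=
  F s s * g s + ∫ t in s..T, kernelDeriv T F t s * g t

/-- `R_F = K_F ∘ K_F^*`. -/
def opR (T : ℝ) (F : ℝ → ℝ → ℝ) (g : ℝ → ℝ) : ℝ → ℝ := opK F (opKStar T F g)

/-- `ψ = (R_F)⁻¹ g`: the class `ψ ∈ L²([0,T])` solves `R_F ψ = g` almost everywhere on `[0,T]`. -/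
def IsRInverse (T : ℝ) (F : ℝ → ℝ → ℝ) (g : Icc (0 : ℝ) T → ℝ) (ψ : Lp ℝ 2 (lebesgueOn T)) :
    Prop :=
  ∀ᵐ t : ℝ, ∀ ht : t ∈ Icc (0 : ℝ) T, opR T F ψ t = g ⟨t, ht⟩

/-- The Cameron-Martin space `ℍ^F = {K_F ḣ : h ∈ ℍ}`; `u` is the derivative `ḣ ∈ L²([0,T])` of
`h(t) = ∫_0^t u(s) ds`. -/
def cameronMartin (T : ℝ) (F : ℝ → ℝ → ℝ) : Set (PathSpace T) :=
  {k | ∃ u : ℝ → ℝ, MemLp u 2 (lebesgueOn T) ∧ ∀ t : Icc (0 : ℝ) T, k t = opK F u t}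

/-- `X = ∫_0^t φ(s) dB_s` (Wiener integral of `φ ∈ L²([0,t])`): step functions on `[0,t]`
approximate `φ` in `L²([0,t])` while their elementary integrals approximate `X` in `L²(P)`. -/
def IsWienerIntegral {Ω : Type*} [MeasurableSpace Ω] (P : Measure Ω) (B : ℝ≥0 → Ω → ℝ)
    (t : ℝ) (φ : ℝ → ℝ) (X : Ω → ℝ) : Prop :=
  MemLp φ 2 (lebesgueOn t) ∧ MemLp X 2 P ∧
    ∀ ε : ℝ≥0∞, 0 < ε → ∃ (n : ℕ) (p : ℕ → ℝ≥0) (c : ℕ → ℝ),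
      Monotone p ∧ (∀ i, (p i : ℝ) ≤ t) ∧
      eLpNorm (fun s => φ s - ∑ i ∈ Finset.range n,
        (Ioc (p i : ℝ) (p (i + 1))).indicator (fun _ => c i) s) 2 (lebesgueOn t) < ε ∧
      eLpNorm (fun ω => X ω - ∑ i ∈ Finset.range n,
        c i * (B (p (i + 1)) ω - B (p i) ω)) 2 P < ε

/-- `Y` is (a version of) the `F`-Gaussian process `B^F_t = ∫_0^t F(t,s) dB_s`, `t ∈ [0,T]`. -/
def IsFGaussian {Ω : Type*} [MeasurableSpace Ω] (P : Measure Ω) (B : ℝ≥0 → Ω → ℝ)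
    (T : ℝ) (F : ℝ → ℝ → ℝ) (Y : Icc (0 : ℝ) T → Ω → ℝ) : Prop :=
  ∀ t : Icc (0 : ℝ) T, IsWienerIntegral P B t (F t) (Y t)

/-- `β = ∫_0^T ψ(s) dY_s`: the `L²(P)`-limit, as the mesh of the partition
`0 = p 0 < ⋯ < p n = T` tends to zero, of
`∑ i, (1 / (p (i+1) - p i) ∫_{p i}^{p (i+1)} ψ(s) ds) (Y_{p (i+1)} - Y_{p i})`. -/
def IsFIntegral {Ω : Type*} [MeasurableSpace Ω] (P : Measure Ω) (T : ℝ)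
    (Y : Icc (0 : ℝ) T → Ω → ℝ) (ψ : ℝ → ℝ) (β : Ω → ℝ) : Prop :=
  MemLp β 2 P ∧
    ∀ ε : ℝ≥0∞, 0 < ε → ∃ δ : ℝ, 0 < δ ∧
      ∀ (n : ℕ) (p : ℕ → Icc (0 : ℝ) T), (p 0 : ℝ) = 0 → (p n : ℝ) = T →
        (∀ i < n, (p i : ℝ) < p (i + 1)) → (∀ i < n, (p (i + 1) : ℝ) - p i < δ) →
        eLpNorm (fun ω => (∑ i ∈ Finset.range n,
          (1 / ((p (i + 1) : ℝ) - p i) * ∫ s in (p i : ℝ)..(p (i + 1) : ℝ), ψ s) *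
            (Y (p (i + 1)) ω - Y (p i) ω)) - β ω) 2 P < ε

/-- Bounded Lipschitz cylinder functions `G(γ) = g(γ(t_1),…,γ(t_m))`, `0 < t_1 < ⋯ < t_m ≤ T`. -/
def IsLipCylinder (T : ℝ) (G : PathSpace T → ℝ) : Prop :=
  ∃ (m : ℕ) (t : Fin m → Icc (0 : ℝ) T) (g : (Fin m → ℝ) → ℝ),
    1 ≤ m ∧ StrictMono t ∧ (∀ i, 0 < (t i : ℝ)) ∧
    (∃ L : ℝ≥0, LipschitzWith L g) ∧ (∃ C : ℝ, ∀ x, |g x| ≤ C) ∧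
    ∀ γ : PathSpace T, G γ = g (fun i => γ (t i))

/-- `D = D_k G`: the limit of `(G(γ + ε k) - G(γ)) / ε` as `ε → 0`, in `L²(μ)`. -/
def IsDirDeriv {T : ℝ} (μ : Measure (PathSpace T)) (k : PathSpace T) (G D : PathSpace T → ℝ) :
    Prop :=
  MemLp D 2 μ ∧
    Tendsto (fun ε : ℝ => eLpNorm (fun γ => (G (γ + ε • k) - G γ) / ε - D γ) 2 μ)
      (𝓝[≠] 0) (𝓝 0)

end

/-!
Write `K` for the Volterra operator of `F̂` and `e t = 𝟙_{[0,t]}` (`stepLp`). Everything is expressed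
through the operator `A = K*` on `L²([0,T])` and the Wiener isometry `W : L²([0,T]) → L²(P)`.

*The operator.* Absolute continuity of `F̂(·,s)` gives `A (e t) = F̂(t,·) 𝟙_{[0,t]}`, so that
`K u (t) = ⟪A (e t), u⟫` and `B^{F̂}_t = W (A (e t))`. The relation of (A4) at `t = r` shows that the
diagonal `F̂(r,r)` does not vanish, hence `A` is the product of an invertible multiplication operator
and of `1 + V`, with `V` a Volterra operator with square integrable kernel. Such a `V` is
quasinilpotent (`isUnit_one_add_volterra`), so `A` is bijective (`exists_starOp`). If
`h^F = K_F u`, then `h^F / f = K u` almost everywhere, and `R ψ = K (A ψ) = K u` has the unique solution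
`ψ = A⁻¹ u` (`isRInverse_iff`).

*The integral.* The Riemann sums defining `∫ ψ dB^{F̂}` are `W (A ψₙ)`, where `ψₙ` is the orthogonal
projection of `ψ` onto the step functions of the partition; these projections converge to `ψ` because
step functions are dense. Hence `β = W (A ψ) = W u` (`isFIntegral_of_isometry`).

*Integration by parts.* The vector `X = (B^F_{t₁}, …, B^F_{t_m})` consists of Wiener integrals and has
covariances `h^F(t_i)` with `Z = W u`. Therefore `X = Y + Z d` with `Y` independent of `Z`, where
`Var(Z) d` is the vector `c = (h^F(t_i))`, and shifting the Gaussian variable `Z` gives the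
Cameron–Martin formula `E g(X + s c) = E [g(X) exp (s Z - s² Var(Z) / 2)]`
(`integral_cameronMartin_shift`). It shows that the law of `X` is quasi-invariant under shifts along
`c`, so the Lipschitz function `g` is differentiable in the direction `c` at almost every value of `X`
(`ae_lineDifferentiableAt`), even if that law is degenerate; its derivative at `s = 0` is the formula
to be proved (`integral_lineDeriv_eq`).
-/

namespace VolterraGaussian

/-! ### Hilbert–Schmidt and Volterra integral operators -/

section HilbertSchmidt

variable {α : Type*} [MeasurableSpace α] {μ : Measure α}

theorem eLpNorm_two_sq (f : α → ℝ) : eLpNorm f 2 μ ^ 2 = ∫⁻ x, ‖f x‖ₑ ^ 2 ∂μ := by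
  have := eLpNorm_nnreal_pow_eq_lintegral (μ := μ) (f := f) (p := 2) (by norm_num)
  simpa using this

theorem lintegral_enorm_sq_lt_top {f : α → ℝ} (hf : MemLp f 2 μ) :
    ∫⁻ x, ‖f x‖ₑ ^ 2 ∂μ < ∞ := by
  rw [← eLpNorm_two_sq]
  exact ENNReal.pow_lt_top hf.2

theorem lintegral_enorm_sq_coeFn (f : Lp ℝ 2 μ) : ∫⁻ x, ‖f x‖ₑ ^ 2 ∂μ = ‖f‖ₑ ^ 2 := by
  rw [← eLpNorm_two_sq, Lp.enorm_def]

/-- The Cauchy–Schwarz inequality, with no integrability assumption. -/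
theorem enorm_integral_mul_sq_le {f g : α → ℝ} (hf : AEMeasurable f μ) (hg : AEMeasurable g μ) :
    ‖∫ x, f x * g x ∂μ‖ₑ ^ 2 ≤ (∫⁻ x, ‖f x‖ₑ ^ 2 ∂μ) * ∫⁻ x, ‖g x‖ₑ ^ 2 ∂μ := by
  have h1 : ‖∫ x, f x * g x ∂μ‖ₑ ≤ ∫⁻ x, ‖f x‖ₑ * ‖g x‖ₑ ∂μ := by
    refine (enorm_integral_le_lintegral_enorm _).trans_eq ?_
    simp only [enorm_mul]
  have h2 := ENNReal.lintegral_mul_le_Lp_mul_Lq μ Real.HolderConjugate.two_two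
    hf.enorm hg.enorm
  have h3 : ∀ a b : ℝ≥0∞, (a ^ (1 / 2 : ℝ) * b ^ (1 / 2 : ℝ)) ^ 2 = a * b := by
    intro a b
    rw [mul_pow, ← ENNReal.rpow_natCast, ← ENNReal.rpow_natCast, ← ENNReal.rpow_mul,
      ← ENNReal.rpow_mul]
    norm_num
  calc _ ≤ _ := pow_le_pow_left' (h1.trans h2) 2
    _ = _ := by
      rw [h3]
      simp only [ENNReal.rpow_ofNat]

variable [SFinite μ] {k : α → α → ℝ}

theorem ae_lintegral_kernel_lt_top (hk : MemLp (Function.uncurry k) 2 (μ.prod μ)) :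
    ∀ᵐ s ∂μ, ∫⁻ t, ‖k s t‖ₑ ^ 2 ∂μ < ∞ := by
  have h := lintegral_enorm_sq_lt_top hk
  have hm : AEMeasurable (fun p : α × α => ‖Function.uncurry k p‖ₑ ^ 2) (μ.prod μ) :=
    hk.1.aemeasurable.enorm.pow_const 2
  rw [lintegral_prod _ hm] at h
  exact ae_lt_top' hm.lintegral_prod_right' h.ne

theorem ae_aemeasurable_kernel (hk : MemLp (Function.uncurry k) 2 (μ.prod μ)) :
    ∀ᵐ s ∂μ, AEMeasurable (k s) μ := by
  filter_upwards [hk.1.prodMk_left] with s hs using hs.aemeasurable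

theorem ae_memLp_kernel (hk : MemLp (Function.uncurry k) 2 (μ.prod μ)) :
    ∀ᵐ s ∂μ, MemLp (k s) 2 μ := by
  filter_upwards [ae_lintegral_kernel_lt_top hk, ae_aemeasurable_kernel hk] with s hs hm
  refine ⟨hm.aestronglyMeasurable, ?_⟩
  rw [← eLpNorm_two_sq] at hs
  exact (ENNReal.pow_lt_top_iff.1 hs).resolve_right (by norm_num)

theorem lintegral_enorm_kernelIntegral_sq_le (hk : MemLp (Function.uncurry k) 2 (μ.prod μ))
    {g : α → ℝ} (hg : AEMeasurable g μ) :
    ∫⁻ s, ‖∫ t, k s t * g t ∂μ‖ₑ ^ 2 ∂μ ≤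
      (∫⁻ p, ‖Function.uncurry k p‖ₑ ^ 2 ∂(μ.prod μ)) * ∫⁻ t, ‖g t‖ₑ ^ 2 ∂μ := by
  have hm : AEMeasurable (fun p : α × α => ‖Function.uncurry k p‖ₑ ^ 2) (μ.prod μ) :=
    hk.1.aemeasurable.enorm.pow_const 2
  rw [lintegral_prod _ hm, ← lintegral_mul_const'' _ hm.lintegral_prod_right']
  refine lintegral_mono_ae ?_
  filter_upwards [ae_aemeasurable_kernel hk] with s hs
  exact enorm_integral_mul_sq_le hs hg

theorem memLp_kernelIntegral (hk : MemLp (Function.uncurry k) 2 (μ.prod μ))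
    {g : α → ℝ} (hg : MemLp g 2 μ) : MemLp (fun s => ∫ t, k s t * g t ∂μ) 2 μ := by
  refine ⟨?_, ?_⟩
  · have : AEStronglyMeasurable (fun p : α × α => k p.1 p.2 * g p.2) (μ.prod μ) :=
      hk.1.mul hg.1.comp_snd
    exact this.integral_prod_right'
  · have h := lintegral_enorm_kernelIntegral_sq_le hk hg.1.aemeasurable
    rw [← eLpNorm_two_sq] at h
    have h2 := h.trans_lt (ENNReal.mul_lt_top (lintegral_enorm_sq_lt_top hk)
      (lintegral_enorm_sq_lt_top hg))
    exact (ENNReal.pow_lt_top_iff.1 h2).resolve_right (by norm_num)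

/-- The Hilbert–Schmidt operator `g ↦ ∫ k(·,t) g(t) dμ(t)` on `L²(μ)` with kernel
`k ∈ L²(μ ⊗ μ)`. -/
noncomputable def hilbertSchmidtOp (k : α → α → ℝ)
    (hk : MemLp (Function.uncurry k) 2 (μ.prod μ)) : Lp ℝ 2 μ →L[ℝ] Lp ℝ 2 μ :=
  LinearMap.mkContinuous
    { toFun := fun g => (memLp_kernelIntegral hk (Lp.memLp g)).toLp _
      map_add' := fun g h => by
        rw [← MemLp.toLp_add]
        refine MemLp.toLp_congr _ _ ?_
        filter_upwards [ae_memLp_kernel hk] with s hs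
        have hg : Integrable (fun t => k s t * g t) μ := hs.integrable_mul (Lp.memLp g)
        have hh : Integrable (fun t => k s t * h t) μ := hs.integrable_mul (Lp.memLp h)
        rw [Pi.add_apply, ← integral_add hg hh]
        refine integral_congr_ae ?_
        filter_upwards [Lp.coeFn_add g h] with t ht
        rw [ht, Pi.add_apply, mul_add]
      map_smul' := fun c g => by
        rw [RingHom.id_apply, ← MemLp.toLp_const_smul]
        refine MemLp.toLp_congr _ _ (Eventually.of_forall fun s => ?_)
        rw [Pi.smul_apply, smul_eq_mul, ← integral_const_mul]
        refine integral_congr_ae ?_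
        filter_upwards [Lp.coeFn_smul c g] with t ht
        rw [ht, Pi.smul_apply, smul_eq_mul]
        ring }
    (eLpNorm (Function.uncurry k) 2 (μ.prod μ)).toReal (fun g => by
      have h := lintegral_enorm_kernelIntegral_sq_le hk (Lp.memLp g).1.aemeasurable
      rw [← eLpNorm_two_sq, ← eLpNorm_two_sq, ← eLpNorm_two_sq, ← mul_pow] at h
      have h' := (ENNReal.pow_le_pow_left_iff two_ne_zero).1 h
      rw [← eLpNorm_congr_ae (memLp_kernelIntegral hk (Lp.memLp g)).coeFn_toLp] at h'
      simp only [LinearMap.coe_mk, AddHom.coe_mk, Lp.norm_def]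
      rw [← ENNReal.toReal_mul]
      exact ENNReal.toReal_mono (ENNReal.mul_ne_top hk.2.ne (Lp.memLp g).2.ne) h')

theorem coeFn_hilbertSchmidtOp (hk : MemLp (Function.uncurry k) 2 (μ.prod μ)) (g : Lp ℝ 2 μ) :
    hilbertSchmidtOp k hk g =ᵐ[μ] fun s => ∫ t, k s t * g t ∂μ :=
  (memLp_kernelIntegral hk (Lp.memLp g)).coeFn_toLp

end HilbertSchmidt

section Volterra

variable {T : ℝ}

theorem lebesgueOn_restrict_Iic {t : ℝ} (ht : t ≤ T) :
    (lebesgueOn T).restrict (Iic t) = lebesgueOn t := by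
  rw [Measure.restrict_restrict measurableSet_Iic]
  congr 1
  ext s
  simp only [mem_inter_iff, mem_Iic, mem_Icc]
  exact ⟨fun h => ⟨h.2.1, h.1⟩, fun h => ⟨h.2, h.1, h.2.trans ht⟩⟩

/-- The weight is `w = exp (4 ∫₀ a)`, so that `w' = 4 a w` almost everywhere. -/
theorem exists_weight {a : ℝ → ℝ} (ha : ∀ s, 0 ≤ a s) (hai : IntegrableOn a (Icc 0 T)) :
    ∃ w : ℝ → ℝ, Continuous w ∧ (∃ C, ∀ t ∈ Icc 0 T, w t ≤ C) ∧ ∀ t ∈ Icc 0 T, 1 ≤ w t ∧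
      ∫⁻ s in Iic t, ENNReal.ofReal (w s) * ENNReal.ofReal (a s) ∂(lebesgueOn T) ≤
        4⁻¹ * ENNReal.ofReal (w t) := by
  set b : ℝ → ℝ := (Icc 0 T).indicator a with hb
  have hb0 : ∀ s, 0 ≤ b s := fun s => indicator_nonneg (fun s _ => ha s) s
  have hbi : Integrable b := hai.integrable_indicator measurableSet_Icc
  set φ : ℝ → ℝ := fun t => ∫ s in (0 : ℝ)..t, b s with hφ
  have hφc : Continuous φ := intervalIntegral.continuous_primitive
    (fun _ _ => hbi.intervalIntegrable) 0
  have hφm : Monotone φ := fun s t hst => by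
    have := intervalIntegral.integral_add_adjacent_intervals
      (hbi.intervalIntegrable (a := 0) (b := s)) (hbi.intervalIntegrable (a := s) (b := t))
    have h2 := intervalIntegral.integral_nonneg hst (fun u _ => hb0 u) (μ := volume)
    simp only [hφ]
    linarith
  set w : ℝ → ℝ := fun t => Real.exp (4 * φ t) with hw
  have hwm : Monotone w := fun s t hst => Real.exp_le_exp.2 (by linarith [hφm hst])
  have hw0 : w 0 = 1 := by simp [hw, hφ]
  have hwc : Continuous w := by fun_prop
  refine ⟨w, hwc, ⟨w T, fun t ht => hwm ht.2⟩, fun t ht => ⟨hw0 ▸ hwm ht.1, ?_⟩⟩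
  have hder : ∀ᵐ s, deriv w s = 4 * (w s * b s) := by
    filter_upwards [_root_.LocallyIntegrable.ae_hasDerivAt_integral hbi.locallyIntegrable] with s hs
    have h := ((hs 0).const_mul 4).exp.deriv
    rw [show deriv w s = _ from h]
    simp only [hw, hφ]
    ring
  have hmono : MonotoneOn w (uIcc 0 t) := hwm.monotoneOn _
  have hint : IntegrableOn (fun s => w s * b s) (Icc 0 t) := by
    have := (intervalIntegrable_iff_integrableOn_Icc_of_le ht.1).1 hmono.intervalIntegrable_deriv
    refine (this.const_mul 4⁻¹).congr ?_
    filter_upwards [ae_restrict_of_ae hder] with s hs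
    rw [hs]; ring
  have hle : ∫ s in (0 : ℝ)..t, w s * b s ≤ 4⁻¹ * w t := by
    have h1 := hmono.intervalIntegral_deriv_mem_uIcc
    rw [uIcc_of_le (sub_nonneg.2 (hwm ht.1)), intervalIntegral.integral_congr_ae
      (g := fun s => 4 * (w s * b s)) (hder.mono fun s hs _ => hs),
      intervalIntegral.integral_const_mul, hw0] at h1
    linarith [h1.2]
  rw [lebesgueOn_restrict_Iic ht.2]
  calc ∫⁻ s in Icc 0 t, ENNReal.ofReal (w s) * ENNReal.ofReal (a s)
      = ∫⁻ s in Icc 0 t, ENNReal.ofReal (w s * b s) := by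
        refine setLIntegral_congr_fun measurableSet_Icc fun s hs => ?_
        have : b s = a s := indicator_of_mem (mem_Icc.2 ⟨hs.1, hs.2.trans ht.2⟩) a
        simp only [this]
        rw [ENNReal.ofReal_mul (Real.exp_pos _).le]
    _ = ENNReal.ofReal (∫ s in Icc 0 t, w s * b s) := by
        rw [ofReal_integral_eq_lintegral_ofReal hint
          (Eventually.of_forall fun s => mul_nonneg (Real.exp_pos _).le (hb0 s))]
    _ ≤ ENNReal.ofReal (4⁻¹ * w t) := by
        rw [integral_Icc_eq_integral_Ioc, ← intervalIntegral.integral_of_le ht.1]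
        exact ENNReal.ofReal_le_ofReal hle
    _ = _ := by
        rw [ENNReal.ofReal_mul (by norm_num), ENNReal.ofReal_inv_of_pos (by norm_num)]
        norm_num

variable {k : ℝ → ℝ → ℝ}

theorem lintegral_weighted_volterra_le
    (hk : MemLp (Function.uncurry k) 2 ((lebesgueOn T).prod (lebesgueOn T)))
    (hV : ∀ s t, t < s → k s t = 0) {W : ℝ → ℝ≥0∞} (hW : Measurable W) {c : ℝ≥0∞}
    (hWc : ∀ t ∈ Icc 0 T, ∫⁻ s in Iic t, W s * ∫⁻ u, ‖k s u‖ₑ ^ 2 ∂(lebesgueOn T)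
      ∂(lebesgueOn T) ≤ c * W t)
    {g : ℝ → ℝ} (hg : AEMeasurable g (lebesgueOn T)) :
    ∫⁻ s, W s * ‖∫ t, k s t * g t ∂(lebesgueOn T)‖ₑ ^ 2 ∂(lebesgueOn T) ≤
      c * ∫⁻ t, W t * ‖g t‖ₑ ^ 2 ∂(lebesgueOn T) := by
  set μ := lebesgueOn T
  set A : ℝ → ℝ≥0∞ := fun s => ∫⁻ u, ‖k s u‖ₑ ^ 2 ∂μ with hA
  have hAm : AEMeasurable A μ := by
    have hm : AEMeasurable (fun p : ℝ × ℝ => ‖Function.uncurry k p‖ₑ ^ 2) (μ.prod μ) :=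
      hk.1.aemeasurable.enorm.pow_const 2
    exact hm.lintegral_prod_right'
  have h1 : ∀ᵐ s ∂μ, W s * ‖∫ t, k s t * g t ∂μ‖ₑ ^ 2 ≤
      ∫⁻ t, (W s * A s) * {p : ℝ × ℝ | p.1 ≤ p.2}.indicator (fun p => ‖g p.2‖ₑ ^ 2) (s, t) ∂μ := by
    filter_upwards [ae_aemeasurable_kernel hk, ae_lintegral_kernel_lt_top hk] with s hs hs'
    have e1 : ∫ t, k s t * g t ∂μ = ∫ t, k s t * (Ici s).indicator g t ∂μ := by
      refine integral_congr_ae (Eventually.of_forall fun t => ?_)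
      by_cases hst : s ≤ t
      · simp [indicator_of_mem (mem_Ici.2 hst)]
      · simp [hV s t (not_le.1 hst)]
    have e2 : ∀ t, ‖(Ici s).indicator g t‖ₑ ^ 2 =
        {p : ℝ × ℝ | p.1 ≤ p.2}.indicator (fun p => ‖g p.2‖ₑ ^ 2) (s, t) := by
      intro t
      by_cases hst : s ≤ t <;> simp [indicator, hst]
    rw [e1]
    have h2 := enorm_integral_mul_sq_le hs (hg.indicator measurableSet_Ici (s := Ici s))
    simp only [e2] at h2
    have hme : AEMeasurable (fun t => {p : ℝ × ℝ | p.1 ≤ p.2}.indicator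
        (fun p => ‖g p.2‖ₑ ^ 2) (s, t)) μ := by
      simp only [← e2]
      exact (hg.indicator measurableSet_Ici).enorm.pow_const 2
    rw [lintegral_const_mul'' _ hme, mul_assoc]
    gcongr
  refine (lintegral_mono_ae h1).trans ?_
  have hmeas : AEMeasurable (Function.uncurry fun s t => (W s * A s) *
      {p : ℝ × ℝ | p.1 ≤ p.2}.indicator (fun p => ‖g p.2‖ₑ ^ 2) (s, t)) (μ.prod μ) := by
    refine AEMeasurable.mul (hW.aemeasurable.mul hAm).comp_fst ?_
    refine AEMeasurable.indicator (hg.comp_snd.enorm.pow_const 2) ?_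
    exact measurableSet_le measurable_fst measurable_snd
  have hWg : AEMeasurable (fun t => W t * ‖g t‖ₑ ^ 2) μ :=
    hW.aemeasurable.mul (hg.enorm.pow_const 2)
  rw [lintegral_lintegral_swap hmeas, ← lintegral_const_mul'' _ hWg]
  refine lintegral_mono_ae ?_
  filter_upwards [ae_restrict_mem measurableSet_Icc] with t ht
  have e3 : ∀ s, (W s * A s) * {p : ℝ × ℝ | p.1 ≤ p.2}.indicator (fun p => ‖g p.2‖ₑ ^ 2) (s, t) =
      (Iic t).indicator (fun s => W s * A s) s * ‖g t‖ₑ ^ 2 := by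
    intro s
    by_cases hst : s ≤ t <;> simp [indicator, hst]
  simp only [e3]
  rw [lintegral_mul_const' _ _ (by simp), lintegral_indicator measurableSet_Iic]
  calc _ ≤ c * W t * ‖g t‖ₑ ^ 2 := by gcongr; exact hWc t ht
    _ = _ := mul_assoc _ _ _

/-- A Volterra operator with a square integrable kernel is quasinilpotent: in the `L²` norm with
weight `w` of `exists_weight`, which is equivalent to the plain one, its norm is at most `1/2`. -/
theorem isUnit_one_add_volterra
    (hk : MemLp (Function.uncurry k) 2 ((lebesgueOn T).prod (lebesgueOn T)))
    (hV : ∀ s t, t < s → k s t = 0) : IsUnit (1 + hilbertSchmidtOp k hk) := by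
  set μ := lebesgueOn T with hμ
  set V := hilbertSchmidtOp k hk with hVdef
  have hm : AEMeasurable (fun p : ℝ × ℝ => ‖Function.uncurry k p‖ₑ ^ 2) (μ.prod μ) :=
    hk.1.aemeasurable.enorm.pow_const 2
  have hAm : AEMeasurable (fun s => ∫⁻ u, ‖k s u‖ₑ ^ 2 ∂μ) μ := hm.lintegral_prod_right'
  obtain ⟨w, hwc, ⟨C, hC⟩, hw⟩ := exists_weight (T := T)
    (a := fun s => (∫⁻ u, ‖k s u‖ₑ ^ 2 ∂μ).toReal) (fun s => ENNReal.toReal_nonneg)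
    (integrable_toReal_of_lintegral_ne_top hAm (by
      have h := lintegral_enorm_sq_lt_top hk
      rw [lintegral_prod _ hm] at h
      exact h.ne))
  set W : ℝ → ℝ≥0∞ := fun s => ENNReal.ofReal (w s) with hWdef
  have hWm : Measurable W := hwc.measurable.ennreal_ofReal
  have hWc : ∀ t ∈ Icc 0 T, ∫⁻ s in Iic t, W s * ∫⁻ u, ‖k s u‖ₑ ^ 2 ∂μ ∂μ ≤ 4⁻¹ * W t := by
    intro t ht
    refine le_trans (le_of_eq ?_) (hw t ht).2
    refine lintegral_congr_ae (ae_restrict_of_ae ?_)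
    filter_upwards [ae_lintegral_kernel_lt_top hk] with s hs
    rw [ENNReal.ofReal_toReal hs.ne]
  have hiter : ∀ (n : ℕ) (g : Lp ℝ 2 μ), ∫⁻ s, W s * ‖(V ^ n) g s‖ₑ ^ 2 ∂μ ≤
      (4⁻¹) ^ n * ∫⁻ s, W s * ‖g s‖ₑ ^ 2 ∂μ := by
    intro n g
    induction n with
    | zero => simp
    | succ n ih =>
      have h1 : ∫⁻ s, W s * ‖(V ^ (n + 1)) g s‖ₑ ^ 2 ∂μ =
          ∫⁻ s, W s * ‖∫ t, k s t * (V ^ n) g t ∂μ‖ₑ ^ 2 ∂μ := by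
        rw [pow_succ', mul_apply_eq_comp]
        refine lintegral_congr_ae ?_
        filter_upwards [coeFn_hilbertSchmidtOp hk ((V ^ n) g)] with s hs
        rw [hVdef, hs]
      rw [h1, pow_succ', mul_assoc]
      exact (lintegral_weighted_volterra_le hk hV hWm hWc (Lp.memLp _).1.aemeasurable).trans
        (by gcongr)
  have hbound : ∀ (n : ℕ) (g : Lp ℝ 2 μ),
      ‖(V ^ n) g‖ₑ ^ 2 ≤ (4⁻¹) ^ n * ENNReal.ofReal C * ‖g‖ₑ ^ 2 := by
    intro n g
    rw [← lintegral_enorm_sq_coeFn, ← lintegral_enorm_sq_coeFn]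
    calc ∫⁻ s, ‖(V ^ n) g s‖ₑ ^ 2 ∂μ ≤ ∫⁻ s, W s * ‖(V ^ n) g s‖ₑ ^ 2 ∂μ := by
          refine lintegral_mono_ae ?_
          filter_upwards [ae_restrict_mem measurableSet_Icc] with s hs
          exact le_mul_of_one_le_left' (ENNReal.one_le_ofReal.2 (hw s hs).1)
      _ ≤ (4⁻¹) ^ n * ∫⁻ s, W s * ‖g s‖ₑ ^ 2 ∂μ := hiter n g
      _ ≤ (4⁻¹) ^ n * ∫⁻ s, ENNReal.ofReal C * ‖g s‖ₑ ^ 2 ∂μ := by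
          refine mul_le_mul_right ?_ _
          refine lintegral_mono_ae ?_
          filter_upwards [ae_restrict_mem measurableSet_Icc] with s hs
          gcongr
          exact ENNReal.ofReal_le_ofReal (hC s hs)
      _ = _ := by
          rw [lintegral_const_mul'' _ ((Lp.memLp g).1.aemeasurable.enorm.pow_const 2), mul_assoc]
  have hbound' : ∀ (n : ℕ), ‖V ^ n‖ ≤ (2⁻¹) ^ n * √(max C 0) := by
    intro n
    refine ContinuousLinearMap.opNorm_le_bound _ (by positivity) fun g => ?_
    have h := ENNReal.toReal_mono (by finiteness) (hbound n g)
    simp only [ENNReal.toReal_pow, ENNReal.toReal_mul, toReal_enorm, ENNReal.toReal_inv,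
      ENNReal.toReal_ofNat, ENNReal.toReal_ofReal'] at h
    refine le_of_sq_le_sq ?_ (by positivity)
    rw [mul_pow, mul_pow, Real.sq_sqrt (le_max_right _ _), ← pow_mul, mul_comm n 2, pow_mul]
    norm_num at h ⊢
    exact h
  have hlim : Tendsto (fun n : ℕ => (2⁻¹ : ℝ) ^ n * √(max C 0)) atTop (𝓝 0) := by
    simpa using (tendsto_pow_atTop_nhds_zero_of_lt_one (r := (2⁻¹ : ℝ)) (by norm_num)
      (by norm_num)).mul_const (√(max C 0))
  obtain ⟨n, hn⟩ := (hlim.eventually_lt_const one_pos).exists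
  have hpow : ‖(-V) ^ n‖ < 1 := by
    rcases Nat.even_or_odd n with h | h
    · rw [h.neg_pow]; exact (hbound' n).trans_lt hn
    · rw [h.neg_pow, norm_neg]; exact (hbound' n).trans_lt hn
  have hu : IsUnit (1 - (-V) ^ n) := isUnit_one_sub_of_norm_lt_one hpow
  have hc : Commute (1 - -V) (∑ i ∈ Finset.range n, (-V) ^ i) :=
    Commute.sum_right _ _ _ fun i _ => (Commute.one_left _).sub_left ((Commute.refl (-V)).pow_right i)
  rw [← mul_neg_geom_sum, hc.isUnit_mul_iff, sub_neg_eq_add] at hu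
  exact hu.1

end Volterra

/-! ### The operator `K*` of a Volterra kernel -/

section Multiplication

variable {α : Type*} [MeasurableSpace α] {μ : Measure α}

/-- Multiplication by an essentially bounded function, as an operator on `L²(μ)`. -/
noncomputable def mulOp (d : α → ℝ) (hd : MemLp d ∞ μ) : Lp ℝ 2 μ →L[ℝ] Lp ℝ 2 μ :=
  (ContinuousLinearMap.mul ℝ ℝ).holderL μ ∞ 2 2 (hd.toLp d)

theorem coeFn_mulOp {d : α → ℝ} (hd : MemLp d ∞ μ) (g : Lp ℝ 2 μ) :
    mulOp d hd g =ᵐ[μ] fun s => d s * g s := by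
  have h := ContinuousLinearMap.coeFn_holder (r := 2) (ContinuousLinearMap.mul ℝ ℝ) (hd.toLp d) g
  filter_upwards [h, hd.coeFn_toLp] with s hs hs'
  rw [mulOp, ContinuousLinearMap.holderL_apply_apply, hs, hs']
  rfl

theorem bijective_mulOp {d : α → ℝ} (hd : MemLp d ∞ μ) (hd' : MemLp (fun s => (d s)⁻¹) ∞ μ)
    (h0 : ∀ᵐ s ∂μ, d s ≠ 0) : Function.Bijective (mulOp d hd) := by
  refine Function.bijective_iff_has_inverse.2 ⟨mulOp _ hd', fun g => ?_, fun g => ?_⟩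
  all_goals
    refine Lp.ext ?_
    filter_upwards [h0, coeFn_mulOp hd g, coeFn_mulOp hd' g, coeFn_mulOp hd (mulOp _ hd' g),
      coeFn_mulOp hd' (mulOp _ hd g)] with s h0 h1 h2 h3 h4
    simp only [h1, h2, h3, h4]
    field_simp

end Multiplication

variable {T : ℝ} {F : ℝ → ℝ → ℝ}

/-- The class of `𝟙_{[0,t]}` in `L²([0,T])`. -/
noncomputable def stepLp (T t : ℝ) : Lp ℝ 2 (lebesgueOn T) :=
  indicatorConstLp 2 (measurableSet_Iic (a := t)) (measure_ne_top _ _) 1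

theorem coeFn_stepLp (T t : ℝ) :
    stepLp T t =ᵐ[lebesgueOn T] (Iic t).indicator (fun _ => (1 : ℝ)) :=
  indicatorConstLp_coeFn

/-- The relation of (A4) on the diagonal `t = r` reads `Θ(r,r) F(r,r) / ζ₁(r) = ζ₂(r) > 0`. -/
theorem CondA4.diag_ne_zero (h : CondA4 T F) {r : ℝ} (hr : r ∈ Icc 0 T) : F r r ≠ 0 := by
  obtain ⟨-, Θ, ζ₁, ζ₂, hd⟩ := h
  intro h0
  have h1 := hd.eq_one r r hr.1 le_rfl hr.2
  rw [h0, intervalIntegral.integral_same] at h1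
  have := hd.ζ₂_pos r hr
  simp at h1
  linarith

theorem CondA4.continuousOn_diag (h : CondA4 T F) : ContinuousOn (fun s => F s s) (Icc 0 T) := by
  have : ContinuousOn (fun s : ℝ => ((s, s) : ℝ × ℝ)) (Icc 0 T) := by fun_prop
  exact h.1.comp this fun s hs => ⟨hs.1, le_rfl, hs.2⟩

theorem memLp_top_of_continuousOn {d : ℝ → ℝ} (hd : ContinuousOn d (Icc 0 T)) :
    MemLp d ∞ (lebesgueOn T) := by
  obtain ⟨C, hC⟩ := isCompact_Icc.exists_bound_of_continuousOn hd
  refine memLp_top_of_bound (hd.aestronglyMeasurable measurableSet_Icc) C ?_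
  filter_upwards [ae_restrict_mem measurableSet_Icc] with s hs using hC s hs

/-- The kernel `(s,t) ↦ ∂F(t,s)/∂t` of the integral part of `K*`, extended by zero off the
triangle `s ≤ t`. -/
noncomputable def starKernel (T : ℝ) (F : ℝ → ℝ → ℝ) (s t : ℝ) : ℝ :=
  (kernelTriangle T).indicator (fun p : ℝ × ℝ => kernelDeriv T F p.1 p.2) (t, s)

theorem measurableSet_kernelTriangle (T : ℝ) : MeasurableSet (kernelTriangle T) :=
  (measurableSet_le measurable_const measurable_snd).inter
    ((measurableSet_le measurable_snd measurable_fst).inter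
      (measurableSet_le measurable_fst measurable_const))

theorem memLp_starKernel (h : CondA1 T F) :
    MemLp (Function.uncurry (starKernel T F)) 2 ((lebesgueOn T).prod (lebesgueOn T)) := by
  have h1 := (memLp_indicator_iff_restrict (measurableSet_kernelTriangle T)).2 h.memLp
  have h2 : MemLp ((kernelTriangle T).indicator (fun p : ℝ × ℝ => kernelDeriv T F p.1 p.2)) 2
      ((lebesgueOn T).prod (lebesgueOn T)) := by
    rw [lebesgueOn, Measure.prod_restrict]
    exact h1.restrict _
  exact h2.comp_measurePreserving Measure.measurePreserving_swap

theorem starKernel_eq_zero {s t : ℝ} (h : t < s) : starKernel T F s t = 0 :=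
  indicator_of_notMem (fun hp => absurd hp.2.1 (not_le.2 h)) _

theorem integral_starKernel {s : ℝ} (hs : s ∈ Icc 0 T) (g : ℝ → ℝ) :
    ∫ t, starKernel T F s t * g t ∂(lebesgueOn T) = ∫ t in s..T, kernelDeriv T F t s * g t := by
  have h1 : (fun t => starKernel T F s t * g t) =
      (Icc s T).indicator (fun t => kernelDeriv T F t s * g t) := by
    ext t
    by_cases ht : t ∈ Icc s T
    · rw [indicator_of_mem ht, starKernel, indicator_of_mem (show (t, s) ∈ kernelTriangle T from
        ⟨hs.1, ht.1, ht.2⟩)]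
    · rw [indicator_of_notMem ht, starKernel, indicator_of_notMem, zero_mul]
      exact fun hp => ht ⟨hp.2.1, hp.2.2⟩
  rw [h1, integral_indicator measurableSet_Icc, Measure.restrict_restrict measurableSet_Icc,
    inter_eq_left.2 (Icc_subset_Icc_left hs.1), integral_Icc_eq_integral_Ioc,
    intervalIntegral.integral_of_le hs.2]

theorem opKStar_congr {g g' : ℝ → ℝ} (h : g =ᵐ[lebesgueOn T] g') :
    opKStar T F g =ᵐ[lebesgueOn T] opKStar T F g' := by
  filter_upwards [h, ae_restrict_mem measurableSet_Icc] with s hs hsT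
  rw [opKStar, opKStar, hs, ← integral_starKernel hsT, ← integral_starKernel hsT]
  congr 1
  refine integral_congr_ae ?_
  filter_upwards [h] with t ht
  rw [ht]

/-- `K* 𝟙_{[0,t]} = F(t,·) 𝟙_{[0,t]}`, by the fundamental theorem of calculus for the absolutely
continuous functions `F(·,s)`. -/
theorem opKStar_indicator (h : CondA1 T F) {t : ℝ} (ht : t ∈ Icc 0 T) :
    opKStar T F ((Iic t).indicator fun _ => (1 : ℝ)) =ᵐ[lebesgueOn T] (Iic t).indicator (F t) := by
  filter_upwards [h.absCont, ae_restrict_mem measurableSet_Icc] with s hs hsT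
  have h1 : ∫ r in s..T, kernelDeriv T F r s * (Iic t).indicator (fun _ => (1 : ℝ)) r =
      ∫ r in Ioc s t, kernelDeriv T F r s := by
    rw [intervalIntegral.integral_of_le hsT.2]
    have : ∀ r, kernelDeriv T F r s * (Iic t).indicator (fun _ => (1 : ℝ)) r =
        (Iic t).indicator (fun r => kernelDeriv T F r s) r := by
      intro r
      by_cases hr : r ∈ Iic t <;> simp [indicator, hr]
    simp only [this]
    rw [integral_indicator measurableSet_Iic, Measure.restrict_restrict measurableSet_Iic]
    congr 2
    ext r
    simp only [mem_inter_iff, mem_Iic, mem_Ioc]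
    constructor
    · rintro ⟨h1, h2, h3⟩; exact ⟨h2, h1⟩
    · rintro ⟨h1, h2⟩; exact ⟨h2, h1, h2.trans ht.2⟩
  rw [opKStar, h1]
  by_cases hst : s ≤ t
  · rw [indicator_of_mem (mem_Iic.2 hst), indicator_of_mem (mem_Iic.2 hst), mul_one,
      ← intervalIntegral.integral_of_le hst]
    have hac : AbsolutelyContinuousOnInterval (fun t => F t s) s t := hs.mono (by
      rw [uIcc_of_le hst, uIcc_of_le hsT.2]; exact Icc_subset_Icc_right ht.2)
    have h2 : ∫ r in s..t, kernelDeriv T F r s = ∫ r in s..t, deriv (fun t => F t s) r := by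
      refine intervalIntegral.integral_congr_ae ?_
      have hne : ∀ᵐ r : ℝ, r ≠ T := by simp [ae_iff]
      filter_upwards [hne] with r hr hrm
      rw [uIoc_of_le hst] at hrm
      exact derivWithin_of_mem_nhds
        (Icc_mem_nhds hrm.1 (lt_of_le_of_ne (hrm.2.trans ht.2) hr))
    rw [h2, hac.integral_deriv_eq_sub]
    ring
  · rw [indicator_of_notMem (by simpa using hst), indicator_of_notMem (by simpa using hst),
      Ioc_eq_empty (by simpa using (not_le.1 hst).le)]
    simp

/-- Under (A1) and (A4), `K*` is an automorphism of `L²([0,T])`: it is the product of the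
multiplication by the nowhere vanishing continuous function `s ↦ F(s,s)` and of a Volterra
perturbation of the identity. -/
theorem exists_starOp (h1 : CondA1 T F) (h4 : CondA4 T F) :
    ∃ A : Lp ℝ 2 (lebesgueOn T) →L[ℝ] Lp ℝ 2 (lebesgueOn T), Function.Bijective A ∧
      (∀ g, A g =ᵐ[lebesgueOn T] opKStar T F g) ∧
      ∀ t ∈ Icc 0 T, A (stepLp T t) =ᵐ[lebesgueOn T] (Iic t).indicator (F t) := by
  have hdc := CondA4.continuousOn_diag h4
  have hd0 : ∀ s ∈ Icc 0 T, F s s ≠ 0 := fun s hs => CondA4.diag_ne_zero h4 hs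
  have hdc' : ContinuousOn (fun s => (F s s)⁻¹) (Icc 0 T) := hdc.inv₀ hd0
  have hd := memLp_top_of_continuousOn hdc
  have hd' := memLp_top_of_continuousOn hdc'
  have hk : MemLp (Function.uncurry fun s t => (F s s)⁻¹ * starKernel T F s t) 2
      ((lebesgueOn T).prod (lebesgueOn T)) := by
    have hd2 : MemLp (fun p : ℝ × ℝ => (F p.1 p.1)⁻¹) ∞ ((lebesgueOn T).prod (lebesgueOn T)) :=
      hd'.comp_fst _
    exact (memLp_starKernel h1).mul hd2
  have hV : ∀ s t, t < s → (F s s)⁻¹ * starKernel T F s t = 0 := fun s t hst => by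
    rw [starKernel_eq_zero hst, mul_zero]
  set V := hilbertSchmidtOp _ hk with hVdef
  have hu : IsUnit (1 + V) := isUnit_one_add_volterra hk hV
  have hmem : ∀ᵐ s ∂(lebesgueOn T), s ∈ Icc 0 T := ae_restrict_mem measurableSet_Icc
  have hform : ∀ g, (mulOp _ hd * (1 + V)) g =ᵐ[lebesgueOn T] opKStar T F g := by
    intro g
    rw [mul_apply_eq_comp]
    filter_upwards [coeFn_mulOp hd ((1 + V) g), Lp.coeFn_add g (V g),
      coeFn_hilbertSchmidtOp hk g, hmem] with s e1 e2 e3 hs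
    rw [e1, add_apply, one_apply_eq_self, e2, Pi.add_apply, e3,
      opKStar, ← integral_starKernel hs]
    simp only [mul_assoc]
    rw [integral_const_mul]
    field_simp [hd0 s hs]
  refine ⟨mulOp _ hd * (1 + V), ?_, hform, fun t ht => ?_⟩
  · have hb : Function.Bijective ⇑(1 + V) := by
      obtain ⟨u, hu⟩ := hu
      rw [← hu]
      exact (ContinuousLinearEquiv.unitsEquiv ℝ _ u).bijective
    exact (bijective_mulOp hd hd' (hmem.mono hd0)).comp hb
  · exact (hform _).trans ((opKStar_congr (coeFn_stepLp T t)).trans (opKStar_indicator h1 ht))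

/-! ### Step functions, and the equation `R ψ = K u` -/

section Steps

variable {T : ℝ} {F : ℝ → ℝ → ℝ}

theorem inner_stepLp {t : ℝ} (ht : t ∈ Icc 0 T) (g : Lp ℝ 2 (lebesgueOn T)) :
    inner ℝ (stepLp T t) g = ∫ s in (0 : ℝ)..t, g s := by
  rw [stepLp, L2.inner_indicatorConstLp_one, lebesgueOn_restrict_Iic ht.2,
    intervalIntegral.integral_of_le ht.1, ← integral_Icc_eq_integral_Ioc]

theorem inner_stepLp_stepLp {s t : ℝ} (hs : s ∈ Icc 0 T) (ht : t ∈ Icc 0 T) :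
    inner ℝ (stepLp T s) (stepLp T t) = min s t := by
  rw [stepLp, stepLp, L2.real_inner_indicatorConstLp_one_indicatorConstLp_one, Iic_inter_Iic,
    measureReal_def, ← Measure.restrict_apply_univ, lebesgueOn_restrict_Iic
    (inf_le_left.trans hs.2), Measure.restrict_apply_univ, Real.volume_Icc, sub_zero, ENNReal.toReal_ofReal (le_min hs.1 ht.1)]

theorem intervalIntegrable_coeFn (hT : 0 ≤ T) (g : Lp ℝ 2 (lebesgueOn T)) :
    IntervalIntegrable g volume 0 T :=
  (intervalIntegrable_iff_integrableOn_Icc_of_le hT).2 ((Lp.memLp g).integrable one_le_two)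

theorem eq_zero_of_inner_stepLp (hT : 0 ≤ T) {g : Lp ℝ 2 (lebesgueOn T)}
    (h : ∀ t ∈ Icc 0 T, inner ℝ (stepLp T t) g = 0) : g = 0 := by
  refine Lp.ext ?_
  rw [EventuallyEq, ae_restrict_iff' measurableSet_Icc]
  have h0 : ∀ᵐ t : ℝ, t ≠ 0 := by simp [ae_iff]
  have hT' : ∀ᵐ t : ℝ, t ≠ T := by simp [ae_iff]
  filter_upwards [(intervalIntegrable_coeFn hT g).ae_hasDerivAt_integral, h0, hT',
    ae_imp_of_ae_restrict (Lp.coeFn_zero ℝ 2 (lebesgueOn T))] with t h1 h2 h3 h4 ht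
  rw [h4 ht]
  rw [uIcc_of_le hT] at h1
  have h5 := h1 ht 0 (left_mem_Icc.2 hT)
  have h6 : (fun x => ∫ s in (0 : ℝ)..x, g s) =ᶠ[𝓝 t] fun _ => 0 := by
    filter_upwards [Icc_mem_nhds (lt_of_le_of_ne ht.1 h2.symm) (lt_of_le_of_ne ht.2 h3)] with x hx
    rw [← inner_stepLp hx, h x hx]
  exact h5.unique ((hasDerivAt_const t 0).congr_of_eventuallyEq h6)

theorem eq_zero_of_ae_inner_stepLp (hT : 0 < T) {g : Lp ℝ 2 (lebesgueOn T)}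
    (h : ∀ᵐ t ∂(lebesgueOn T), inner ℝ (stepLp T t) g = 0) : g = 0 := by
  refine eq_zero_of_inner_stepLp hT.le ?_
  have hc : ContinuousOn (fun t => ∫ s in (0 : ℝ)..t, g s) (Icc 0 T) := by
    have := intervalIntegral.continuousOn_primitive_interval'
      (intervalIntegrable_coeFn hT.le g) left_mem_uIcc
    rwa [uIcc_of_le hT.le] at this
  have hae : (fun t => ∫ s in (0 : ℝ)..t, g s) =ᵐ[volume.restrict (Icc 0 T)] fun _ => 0 := by
    filter_upwards [h, ae_restrict_mem measurableSet_Icc] with t ht htT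
    rw [← inner_stepLp htT, ht]
  intro t ht
  rw [inner_stepLp ht]
  exact Measure.eqOn_Icc_of_ae_eq volume hT.ne hae hc continuousOn_const ht

theorem dense_span_stepLp (hT : 0 ≤ T) :
    (Submodule.span ℝ (range fun t : Icc 0 T => stepLp T t)).topologicalClosure = ⊤ := by
  rw [Submodule.topologicalClosure_eq_top_iff, Submodule.eq_bot_iff]
  intro g hg
  refine eq_zero_of_inner_stepLp hT fun t ht => ?_
  exact (Submodule.mem_orthogonal _ _).1 hg _ (Submodule.subset_span ⟨⟨t, ht⟩, rfl⟩)

/-- If `φ = F(t,·) 𝟙_{[0,t]}` then `K u(t) = ⟪φ, u⟫`. -/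
theorem inner_eq_opK {t : ℝ} (ht : t ∈ Icc 0 T) {φ g : Lp ℝ 2 (lebesgueOn T)} {u : ℝ → ℝ}
    (hφ : φ =ᵐ[lebesgueOn T] (Iic t).indicator (F t)) (hu : g =ᵐ[lebesgueOn T] u) :
    inner ℝ φ g = opK F u t := by
  rw [L2.inner_def, opK, intervalIntegral.integral_of_le ht.1, ← integral_Icc_eq_integral_Ioc]
  have h1 : ∫ s, inner ℝ (φ s) (g s) ∂(lebesgueOn T) =
      ∫ s, (Iic t).indicator (fun s => F t s * u s) s ∂(lebesgueOn T) := by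
    refine integral_congr_ae ?_
    filter_upwards [hφ, hu] with s h1 h2
    rw [h1, h2]
    by_cases hs : s ∈ Iic t <;> simp [indicator, hs, mul_comm]
  rw [h1, integral_indicator measurableSet_Iic, lebesgueOn_restrict_Iic ht.2]

variable {A : Lp ℝ 2 (lebesgueOn T) →L[ℝ] Lp ℝ 2 (lebesgueOn T)}

theorem opR_eq_inner (hA : ∀ g, A g =ᵐ[lebesgueOn T] opKStar T F g)
    (hstep : ∀ t ∈ Icc 0 T, A (stepLp T t) =ᵐ[lebesgueOn T] (Iic t).indicator (F t))
    {t : ℝ} (ht : t ∈ Icc 0 T) (ψ : Lp ℝ 2 (lebesgueOn T)) :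
    opR T F ψ t = inner ℝ (A (stepLp T t)) (A ψ) :=
  (inner_eq_opK ht (hstep t ht) (hA ψ)).symm

/-- `K` is injective on `L²`, since `⟪K* 𝟙_{[0,t]}, v⟫ = 0` for almost all `t` forces the adjoint of
the surjective operator `K*` to vanish at `v`. -/
theorem eq_zero_of_ae_opK_eq_zero (hT : 0 < T) (hsurj : Function.Surjective A)
    {v : Lp ℝ 2 (lebesgueOn T)}
    (h : ∀ᵐ t ∂(lebesgueOn T), inner ℝ (A (stepLp T t)) v = 0) : v = 0 := by
  have h1 : ContinuousLinearMap.adjoint A v = 0 := by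
    refine eq_zero_of_ae_inner_stepLp hT ?_
    filter_upwards [h] with t ht
    rw [ContinuousLinearMap.adjoint_inner_right, ht]
  obtain ⟨w, rfl⟩ := hsurj v
  rw [← inner_self_eq_zero (𝕜 := ℝ), ← ContinuousLinearMap.adjoint_inner_right, h1,
    inner_zero_right]

end Steps

/-! ### The Wiener integral -/

section Wiener

variable {Ω : Type*} [MeasurableSpace Ω] {P : Measure Ω} {B : ℝ≥0 → Ω → ℝ} {T : ℝ}

theorem _root_.ProbabilityTheory.IsPreBrownianReal.memLp_two (hB : IsPreBrownianReal B P)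
    (t : ℝ≥0) : MemLp (B t) 2 P :=
  (hB.isGaussianProcess.hasGaussianLaw_eval t).memLp_two

theorem inner_brownian (hB : IsPreBrownianReal B P) (s t : ℝ≥0) :
    inner ℝ ((hB.memLp_two s).toLp) ((hB.memLp_two t).toLp) = min (s : ℝ) t := by
  have : IsProbabilityMeasure P := hB.isGaussianProcess.isProbabilityMeasure
  rw [L2.inner_def]
  have h1 : ∫ ω, inner ℝ ((hB.memLp_two s).toLp (B s) ω) ((hB.memLp_two t).toLp (B t) ω) ∂P =
      ∫ ω, (B s * B t) ω ∂P := by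
    refine integral_congr_ae ?_
    filter_upwards [(hB.memLp_two s).coeFn_toLp, (hB.memLp_two t).coeFn_toLp] with ω h1 h2
    rw [h1, h2]
    simp [mul_comm]
  have h2 := hB.covariance_eval s t
  rw [covariance_eq_sub (hB.memLp_two s) (hB.memLp_two t), hB.integral_eval, zero_mul,
    sub_zero] at h2
  rw [h1, h2]
  simp

theorem norm_linearCombination_eq {ι E E' : Type*} [NormedAddCommGroup E] [InnerProductSpace ℝ E]
    [NormedAddCommGroup E'] [InnerProductSpace ℝ E'] {v : ι → E} {v' : ι → E'}
    (h : ∀ i j, inner ℝ (v i) (v j) = inner ℝ (v' i) (v' j)) (x : ι →₀ ℝ) :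
    ‖Finsupp.linearCombination ℝ v x‖ = ‖Finsupp.linearCombination ℝ v' x‖ := by
  rw [← sq_eq_sq₀ (norm_nonneg _) (norm_nonneg _), ← real_inner_self_eq_norm_sq,
    ← real_inner_self_eq_norm_sq]
  simp only [Finsupp.linearCombination_apply, Finsupp.sum, sum_inner, inner_sum, inner_smul_left,
    inner_smul_right, h]

theorem continuous_integral_cexp [IsProbabilityMeasure P] :
    Continuous fun X : Lp ℝ 2 P => ∫ ω, Complex.exp (X ω * Complex.I) ∂P := by
  have hint : ∀ X : Lp ℝ 2 P, Integrable (fun ω => Complex.exp (X ω * Complex.I)) P := by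
    intro X
    refine Integrable.of_bound ?_ 1 (Eventually.of_forall fun ω => ?_)
    · have := (Lp.memLp X).1.aemeasurable
      exact (by fun_prop : AEMeasurable (fun ω => Complex.exp (X ω * Complex.I)) P).aestronglyMeasurable
    · rw [Complex.norm_exp_ofReal_mul_I]
  have hlip : LipschitzWith 1 fun X : Lp ℝ 2 P => ∫ ω, Complex.exp (X ω * Complex.I) ∂P := by
    refine LipschitzWith.of_dist_le_mul fun X Y => ?_
    rw [NNReal.coe_one, one_mul, dist_eq_norm, dist_eq_norm, ← integral_sub (hint X) (hint Y)]
    have hXY : MemLp (fun ω => (X - Y : Lp ℝ 2 P) ω) 2 P := Lp.memLp _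
    calc ‖∫ ω, (Complex.exp (X ω * Complex.I) - Complex.exp (Y ω * Complex.I)) ∂P‖
        ≤ ∫ ω, ‖(X - Y : Lp ℝ 2 P) ω‖ ∂P := by
          refine norm_integral_le_of_norm_le (hXY.integrable one_le_two).norm ?_
          filter_upwards [Lp.coeFn_sub X Y] with ω hω
          rw [hω, Pi.sub_apply]
          have : Complex.exp (X ω * Complex.I) - Complex.exp (Y ω * Complex.I) =
              Complex.exp (Y ω * Complex.I) * (Complex.exp (Complex.I * ((X ω - Y ω : ℝ))) - 1) := by
            rw [mul_sub, ← Complex.exp_add, mul_one]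
            congr 2
            push_cast; ring
          rw [this, norm_mul, Complex.norm_exp_ofReal_mul_I, one_mul]
          exact Real.norm_exp_I_mul_ofReal_sub_one_le
      _ = (eLpNorm (X - Y : Lp ℝ 2 P) 1 P).toReal := by
          rw [integral_norm_eq_lintegral_enorm hXY.1, eLpNorm_one_eq_lintegral_enorm]
      _ ≤ ‖X - Y‖ := by
          rw [Lp.norm_def]
          exact ENNReal.toReal_mono hXY.2.ne (eLpNorm_le_eLpNorm_of_exponent_le one_le_two hXY.1)
  exact hlip.continuous

/-- The Wiener integral with respect to the Brownian motion `B` on `[0,T]`: the isometry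
`L²([0,T]) → L²(P)` sending `𝟙_{[0,t]}` to `B_t`; all its values are centered Gaussian. -/
theorem exists_wienerIsometry [IsProbabilityMeasure P] (hB : IsPreBrownianReal B P) (hT : 0 ≤ T) :
    ∃ W : Lp ℝ 2 (lebesgueOn T) →L[ℝ] Lp ℝ 2 P, (∀ φ, ‖W φ‖ = ‖φ‖) ∧
      (∀ t : ℝ≥0, (t : ℝ) ≤ T → W (stepLp T t) =ᵐ[P] B t) ∧
      ∀ φ, ∫ ω, Complex.exp (W φ ω * Complex.I) ∂P = Complex.exp (-(‖φ‖ ^ 2 / 2 : ℝ)) := by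
  set b : Icc 0 T → Lp ℝ 2 P := fun t => (hB.memLp_two (t : ℝ).toNNReal).toLp with hb
  set e₁ := Finsupp.linearCombination ℝ fun t : Icc 0 T => stepLp T t with he₁
  set e₂ := Finsupp.linearCombination ℝ b with he₂
  have hnorm : ∀ x, ‖e₂ x‖ = ‖e₁ x‖ := by
    refine fun x => norm_linearCombination_eq (fun s t => ?_) x
    rw [inner_stepLp_stepLp s.2 t.2, hb, inner_brownian hB, Real.coe_toNNReal _ s.2.1,
      Real.coe_toNNReal _ t.2.1]
  have hdense : DenseRange e₁ := by
    have h := dense_span_stepLp hT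
    rw [← Finsupp.range_linearCombination] at h
    rw [DenseRange, ← LinearMap.coe_range]
    exact (Submodule.dense_iff_topologicalClosure_eq_top).2 h
  have hext : ∀ x, e₂.extendOfNorm e₁ (e₁ x) = e₂ x := fun x =>
    LinearMap.extendOfNorm_eq hdense ⟨1, fun x => by rw [hnorm, one_mul]⟩ x
  set W := e₂.extendOfNorm e₁ with hW
  have hWn : ∀ φ, ‖W φ‖ = ‖φ‖ := by
    intro φ
    refine hdense.induction_on φ (isClosed_eq (by fun_prop) (by fun_prop)) fun x => ?_
    rw [hext, hnorm]
  refine ⟨W, hWn, fun t ht => ?_, fun φ => ?_⟩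
  · have h1 : e₁ (Finsupp.single ⟨t, t.2, ht⟩ 1) = stepLp T t := by simp [he₁]
    have h2 : e₂ (Finsupp.single ⟨t, t.2, ht⟩ 1) = (hB.memLp_two t).toLp := by simp [he₂, hb]
    rw [← h1, hext, h2]
    exact MemLp.coeFn_toLp _
  · refine hdense.induction_on φ (isClosed_eq ?_ (by fun_prop)) fun x => ?_
    · exact continuous_integral_cexp.comp W.continuous
    · rw [hext, ← hnorm]
      have hae : e₂ x =ᵐ[P] fun ω => ∑ t ∈ x.support, x t * B (t : ℝ).toNNReal ω := by
        rw [he₂, Finsupp.linearCombination_apply, Finsupp.sum]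
        have h1 : ∀ t : Icc 0 T, (x t • b t : Lp ℝ 2 P) =ᵐ[P]
            fun ω => x t * B (t : ℝ).toNNReal ω := by
          intro t
          filter_upwards [Lp.coeFn_smul (x t) (b t),
            (hB.memLp_two (t : ℝ).toNNReal).coeFn_toLp] with ω h1 h2
          rw [h1, Pi.smul_apply, h2, smul_eq_mul]
        have h2 : ∀ᵐ ω ∂P, ∀ t ∈ x.support, (x t • b t : Lp ℝ 2 P) ω =
            x t * B (t : ℝ).toNNReal ω :=
          (Finset.eventually_all _).2 fun t _ => h1 t
        filter_upwards [Lp.coeFn_finsetSum x.support (fun t => x t • b t), h2] with ω h3 h4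
        rw [h3, Finset.sum_apply]
        exact Finset.sum_congr rfl h4
      have hG : HasGaussianLaw (e₂ x) P := by
        have hg := (hB.isGaussianProcess.comp_right fun t : Icc 0 T => (t : ℝ).toNNReal).smul x
        exact (hg.hasGaussianLaw_fun_sum (I := x.support)).congr hae.symm
      have hmean : ∫ ω, e₂ x ω ∂P = 0 := by
        rw [integral_congr_ae hae, integral_finsetSum _ fun t _ =>
          (hB.integrable_eval _).const_mul _]
        refine Finset.sum_eq_zero fun t _ => ?_
        rw [integral_const_mul, hB.integral_eval, mul_zero]
      have hvar : Var[e₂ x; P] = ‖e₂ x‖ ^ 2 := by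
        rw [variance_of_integral_eq_zero hG.aemeasurable hmean, ← real_inner_self_eq_norm_sq,
          L2.inner_def]
        simp [sq]
      have hc := hG.charFun_map_eq (1 : ℝ)
      rw [charFun_apply, integral_map hG.aemeasurable (by fun_prop)] at hc
      simp only [one_mul, RCLike.inner_apply, conj_trivial, mul_one] at hc
      rw [hmean, hvar] at hc
      rw [hc]
      push_cast
      simp

end Wiener

section WienerProperties

variable {Ω : Type*} [MeasurableSpace Ω] {P : Measure Ω}
  {B : ℝ≥0 → Ω → ℝ} {T : ℝ} {W : Lp ℝ 2 (lebesgueOn T) →L[ℝ] Lp ℝ 2 P}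

theorem integral_mul_of_isometry (hW : ∀ φ, ‖W φ‖ = ‖φ‖) (φ ψ : Lp ℝ 2 (lebesgueOn T)) :
    ∫ ω, W φ ω * W ψ ω ∂P = inner ℝ φ ψ := by
  have h := LinearIsometry.inner_map_map (𝕜 := ℝ) ⟨W.toLinearMap, hW⟩ φ ψ
  rw [← h, L2.inner_def]
  refine integral_congr_ae (Eventually.of_forall fun ω => ?_)
  simp [mul_comm]

theorem map_wiener_eq_gaussianReal [IsProbabilityMeasure P]
    (hWc : ∀ φ, ∫ ω, Complex.exp (W φ ω * Complex.I) ∂P = Complex.exp (-(‖φ‖ ^ 2 / 2 : ℝ)))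
    (φ : Lp ℝ 2 (lebesgueOn T)) : P.map (W φ) = gaussianReal 0 (‖φ‖₊ ^ 2) := by
  have hm : AEMeasurable (W φ) P := (Lp.memLp (W φ)).1.aemeasurable
  have : IsProbabilityMeasure (P.map (W φ)) := Measure.isProbabilityMeasure_map hm
  refine Measure.ext_of_charFun ?_
  ext a
  rw [charFun_gaussianReal, charFun_apply, integral_map hm (by fun_prop)]
  have h1 : ∫ ω, Complex.exp ((inner ℝ (W φ ω) a : ℝ) * Complex.I) ∂P =
      ∫ ω, Complex.exp (W (a • φ) ω * Complex.I) ∂P := by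
    refine integral_congr_ae ?_
    rw [map_smul]
    filter_upwards [Lp.coeFn_smul a (W φ)] with ω hω
    rw [hω]
    simp
  rw [h1, hWc, norm_smul, mul_pow, Real.norm_eq_abs, sq_abs]
  congr 1
  push_cast
  simp
  ring

theorem hasGaussianLaw_wiener [IsProbabilityMeasure P]
    (hWc : ∀ φ, ∫ ω, Complex.exp (W φ ω * Complex.I) ∂P = Complex.exp (-(‖φ‖ ^ 2 / 2 : ℝ)))
    (φ : Lp ℝ 2 (lebesgueOn T)) : HasGaussianLaw (W φ) P :=
  ⟨by rw [map_wiener_eq_gaussianReal hWc φ]; infer_instance⟩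

theorem integral_wiener [IsProbabilityMeasure P]
    (hWc : ∀ φ, ∫ ω, Complex.exp (W φ ω * Complex.I) ∂P = Complex.exp (-(‖φ‖ ^ 2 / 2 : ℝ)))
    (φ : Lp ℝ 2 (lebesgueOn T)) : ∫ ω, W φ ω ∂P = 0 := by
  have h := integral_id_gaussianReal (μ := 0) (v := ‖φ‖₊ ^ 2)
  rw [← map_wiener_eq_gaussianReal hWc φ,
    integral_map (Lp.memLp (W φ)).1.aemeasurable (by fun_prop)] at h
  exact h

/-- Wiener integrals are jointly Gaussian, so orthogonality of the integrands gives independence. -/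
theorem indepFun_wiener [IsProbabilityMeasure P] (hW : ∀ φ, ‖W φ‖ = ‖φ‖)
    (hWc : ∀ φ, ∫ ω, Complex.exp (W φ ω * Complex.I) ∂P = Complex.exp (-(‖φ‖ ^ 2 / 2 : ℝ)))
    {m : ℕ} (φ : Fin m → Lp ℝ 2 (lebesgueOn T)) (u : Lp ℝ 2 (lebesgueOn T))
    (h : ∀ i, inner ℝ (φ i) u = 0) :
    IndepFun (fun ω i => W (φ i) ω) (W u) P := by
  have hm : ∀ φ, AEMeasurable (W φ) P := fun φ => (Lp.memLp (W φ)).1.aemeasurable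
  have hpair : AEMeasurable (fun ω => ((fun i => W (φ i) ω), (fun _ : Unit => W u ω))) P :=
    (aemeasurable_pi_lambda _ fun i => hm _).prodMk (aemeasurable_pi_lambda _ fun _ => hm _)
  have hG : HasGaussianLaw (fun ω => ((fun i => W (φ i) ω), (fun _ : Unit => W u ω))) P := by
    refine ⟨isGaussian_of_isGaussian_map fun L => ?_⟩
    rw [AEMeasurable.map_map_of_aemeasurable (by fun_prop) hpair]
    have h1 : (fun x : (Fin m → ℝ) × (Unit → ℝ) => L x) = fun x =>
        ∑ i, x.1 i * L (Pi.single i 1, 0) + x.2 () * L (0, fun _ => 1) := by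
      ext ⟨x, y⟩
      have e1 : ((x, y) : (Fin m → ℝ) × (Unit → ℝ)) =
          ∑ i, x i • ((Pi.single i 1, 0) : (Fin m → ℝ) × (Unit → ℝ)) +
            y () • ((0, fun _ => 1) : (Fin m → ℝ) × (Unit → ℝ)) := by
        refine Prod.ext ?_ ?_
        · ext j
          simp [Prod.fst_sum, Pi.single_apply]
        · ext j
          simp [Prod.snd_sum]
      conv_lhs => rw [e1]
      rw [map_add, map_sum, map_smul]
      simp only [map_smul, smul_eq_mul]
    have h2 : (L ∘ fun ω => ((fun i => W (φ i) ω), (fun _ : Unit => W u ω))) =ᵐ[P]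
        W (∑ i, L (Pi.single i 1, 0) • φ i + L (0, fun _ => 1) • u) := by
      rw [map_add, map_sum]
      simp only [map_smul]
      have h3 : ∀ᵐ ω ∂P, ∀ i, (L (Pi.single i 1, 0) • W (φ i) : Lp ℝ 2 P) ω =
          L (Pi.single i 1, 0) * W (φ i) ω :=
        ae_all_iff.2 fun i => Lp.coeFn_smul _ _
      filter_upwards [h3, Lp.coeFn_smul (L (0, fun _ => 1)) (W u),
        Lp.coeFn_add (∑ i, L (Pi.single i 1, 0) • W (φ i)) (L (0, fun _ => 1) • W u),
        Lp.coeFn_finsetSum Finset.univ fun i => L (Pi.single i 1, 0) • W (φ i)]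
        with ω h3 h4 h5 h6
      rw [h5, Pi.add_apply, h4, h6, Finset.sum_apply]
      have := congrFun h1 ((fun i => W (φ i) ω), (fun _ : Unit => W u ω))
      simp only [Function.comp_apply, this, h3, Pi.smul_apply, smul_eq_mul]
      simp only [mul_comm]
    rw [Measure.map_congr h2]
    exact (hasGaussianLaw_wiener hWc _).isGaussian_map
  have hind := HasGaussianLaw.indepFun_of_covariance_eval (X := fun i => W (φ i))
    (Y := fun _ : Unit => W u) hG fun i _ => by
      rw [covariance_eq_sub (Lp.memLp _) (Lp.memLp _), integral_wiener hWc, zero_mul, sub_zero]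
      exact (integral_mul_of_isometry hW _ _).trans (h i)
  exact hind.comp measurable_id (measurable_pi_apply ())

/-- Every Wiener integral in the sense of `IsWienerIntegral` is a value of the isometry. -/
theorem IsWienerIntegral.ae_eq (hW : ∀ φ, ‖W φ‖ = ‖φ‖)
    (hWB : ∀ t : ℝ≥0, (t : ℝ) ≤ T → W (stepLp T t) =ᵐ[P] B t) {t : ℝ} (ht : t ∈ Icc 0 T)
    {φ : ℝ → ℝ} {X : Ω → ℝ} (hX : IsWienerIntegral P B t φ X) {φ' : Lp ℝ 2 (lebesgueOn T)}
    (hφ' : φ' =ᵐ[lebesgueOn T] (Iic t).indicator φ) : X =ᵐ[P] W φ' := by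
  obtain ⟨hφ, hX2, happ⟩ := hX
  suffices h : hX2.toLp X = W φ' by
    rw [← h]; exact hX2.coeFn_toLp.symm
  refine eq_of_forall_dist_le fun ε hε => ?_
  obtain ⟨n, p, c, hp, hpt, h1, h2⟩ := happ (ENNReal.ofReal (ε / 2)) (by simpa using hε)
  set S : Lp ℝ 2 (lebesgueOn T) :=
    ∑ i ∈ Finset.range n, c i • (stepLp T (p (i + 1)) - stepLp T (p i)) with hS
  have hS1 : ∀ᵐ s ∂(lebesgueOn T), (φ' - S : Lp ℝ 2 (lebesgueOn T)) s =
      (Iic t).indicator (fun s => φ s - ∑ i ∈ Finset.range n,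
        (Ioc (p i : ℝ) (p (i + 1))).indicator (fun _ => c i) s) s := by
    have e1 : ∀ᵐ s ∂(lebesgueOn T), ∀ i, (c i • (stepLp T (p (i + 1)) - stepLp T (p i)) :
        Lp ℝ 2 (lebesgueOn T)) s = (Ioc (p i : ℝ) (p (i + 1))).indicator (fun _ => c i) s := by
      refine ae_all_iff.2 fun i => ?_
      filter_upwards [Lp.coeFn_smul (c i) (stepLp T (p (i + 1)) - stepLp T (p i)),
        Lp.coeFn_sub (stepLp T (p (i + 1))) (stepLp T (p i)), coeFn_stepLp T (p i),
        coeFn_stepLp T (p (i + 1))] with s e1 e2 e3 e4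
      rw [e1, Pi.smul_apply, e2, Pi.sub_apply, e3, e4]
      have hpi : (p i : ℝ) ≤ p (i + 1) := hp (Nat.le_succ i)
      simp only [indicator, mem_Iic, mem_Ioc, smul_eq_mul]
      by_cases a1 : s ≤ p i
      · simp [a1, a1.trans hpi, not_lt.2 a1]
      · by_cases a2 : s ≤ p (i + 1) <;> simp [a1, a2, not_le.1 a1]
    filter_upwards [e1, Lp.coeFn_sub φ' S, hφ', Lp.coeFn_finsetSum (Finset.range n)
      fun i => c i • (stepLp T (p (i + 1)) - stepLp T (p i))] with s e1 e2 e3 e4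
    rw [e2, Pi.sub_apply, e3, hS, e4, Finset.sum_apply]
    simp only [e1]
    by_cases hs : s ∈ Iic t
    · rw [indicator_of_mem hs, indicator_of_mem hs]
    · rw [indicator_of_notMem hs, indicator_of_notMem hs, zero_sub, neg_eq_zero]
      refine Finset.sum_eq_zero fun i _ => indicator_of_notMem (fun h => hs ?_) _
      exact h.2.trans (hpt (i + 1))
  have hS2 : ∀ᵐ ω ∂P, (hX2.toLp X - W S : Lp ℝ 2 P) ω =
      X ω - ∑ i ∈ Finset.range n, c i * (B (p (i + 1)) ω - B (p i) ω) := by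
    have hpT : ∀ i, (p i : ℝ) ≤ T := fun i => (hpt i).trans ht.2
    have e1 : ∀ᵐ ω ∂P, ∀ i, (c i • (W (stepLp T (p (i + 1))) - W (stepLp T (p i))) :
        Lp ℝ 2 P) ω = c i * (B (p (i + 1)) ω - B (p i) ω) := by
      refine ae_all_iff.2 fun i => ?_
      filter_upwards [Lp.coeFn_smul (c i) (W (stepLp T (p (i + 1))) - W (stepLp T (p i))),
        Lp.coeFn_sub (W (stepLp T (p (i + 1)))) (W (stepLp T (p i))), hWB _ (hpT i),
        hWB _ (hpT (i + 1))] with s e1 e2 e3 e4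
      rw [e1, Pi.smul_apply, e2, Pi.sub_apply, e3, e4, smul_eq_mul]
    have e0 : W S = ∑ i ∈ Finset.range n,
        c i • (W (stepLp T (p (i + 1))) - W (stepLp T (p i))) := by
      simp only [hS, map_sum, map_smul, map_sub]
    rw [e0]
    filter_upwards [e1, Lp.coeFn_sub (hX2.toLp X) (∑ i ∈ Finset.range n,
        c i • (W (stepLp T (p (i + 1))) - W (stepLp T (p i)))), hX2.coeFn_toLp,
      Lp.coeFn_finsetSum (Finset.range n)
      fun i => c i • (W (stepLp T (p (i + 1))) - W (stepLp T (p i)))] with s e1 e2 e3 e4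
    rw [e2, Pi.sub_apply, e3, e4, Finset.sum_apply]
    simp only [e1]
  have n1 : ‖φ' - S‖ ≤ ε / 2 := by
    rw [Lp.norm_def, eLpNorm_congr_ae hS1, eLpNorm_indicator_eq_eLpNorm_restrict
      measurableSet_Iic, lebesgueOn_restrict_Iic ht.2]
    exact (ENNReal.toReal_lt_of_lt_ofReal h1).le
  have n2 : ‖hX2.toLp X - W S‖ ≤ ε / 2 := by
    rw [Lp.norm_def, eLpNorm_congr_ae hS2]
    exact (ENNReal.toReal_lt_of_lt_ofReal h2).le
  calc dist (hX2.toLp X) (W φ') ≤ dist (hX2.toLp X) (W S) + dist (W S) (W φ') :=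
        dist_triangle _ _ _
    _ = ‖hX2.toLp X - W S‖ + ‖φ' - S‖ := by
        rw [dist_eq_norm, dist_eq_norm, ← map_sub, hW, norm_sub_rev S]
    _ ≤ ε := by linarith

end WienerProperties

/-! ### Averaging over fine partitions -/

section Averaging

variable {T : ℝ} {n : ℕ} {p : ℕ → Icc (0 : ℝ) T}

/-- The class of `𝟙_{(p i, p (i+1)]}` in `L²([0,T])`. -/
noncomputable def cellLp (p : ℕ → Icc (0 : ℝ) T) (i : ℕ) : Lp ℝ 2 (lebesgueOn T) :=
  stepLp T (p (i + 1)) - stepLp T (p i)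

/-- The step function equal on each cell `(p i, p (i+1)]`, `i < n`, to the mean of `ψ` there. -/
noncomputable def averageLp (n : ℕ) (p : ℕ → Icc (0 : ℝ) T) (ψ : Lp ℝ 2 (lebesgueOn T)) :
    Lp ℝ 2 (lebesgueOn T) :=
  ∑ i ∈ Finset.range n,
    (1 / ((p (i + 1) : ℝ) - p i) * ∫ s in (p i : ℝ)..(p (i + 1) : ℝ), ψ s) • cellLp p i

theorem partition_mono (hp : ∀ i < n, (p i : ℝ) < p (i + 1)) {i j : ℕ} (hij : i ≤ j)
    (hj : j ≤ n) : (p i : ℝ) ≤ p j := by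
  induction j, hij using Nat.le_induction with
  | base => exact le_rfl
  | succ k hk ih => exact (ih (by omega)).trans (hp k (by omega)).le

theorem inner_cellLp (i : ℕ) (ψ : Lp ℝ 2 (lebesgueOn T)) :
    inner ℝ (cellLp p i) ψ = ∫ s in (p i : ℝ)..(p (i + 1) : ℝ), ψ s := by
  have hT : 0 ≤ T := (p 0).2.1.trans (p 0).2.2
  have hi : ∀ t ∈ Icc 0 T, IntervalIntegrable ψ volume 0 t := fun t ht =>
    (intervalIntegrable_coeFn hT ψ).mono_set (by
      rw [uIcc_of_le ht.1, uIcc_of_le hT]; exact Icc_subset_Icc_right ht.2)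
  rw [cellLp, inner_sub_left, inner_stepLp (p (i + 1)).2, inner_stepLp (p i).2,
    intervalIntegral.integral_interval_sub_left (hi _ (p (i + 1)).2) (hi _ (p i).2)]

theorem inner_cellLp_cellLp (hp : ∀ i < n, (p i : ℝ) < p (i + 1)) {i j : ℕ} (hi : i < n)
    (hj : j < n) : inner ℝ (cellLp p i) (cellLp p j) =
      if i = j then (p (i + 1) : ℝ) - p i else 0 := by
  simp only [cellLp, inner_sub_left, inner_sub_right, inner_stepLp_stepLp (p _).2 (p _).2]
  rcases lt_trichotomy i j with h | h | h
  · have h1 := partition_mono hp (i := i + 1) (j := j) h hj.le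
    have h2 := hp i hi
    have h3 := hp j hj
    rw [min_eq_left (by linarith), min_eq_left (by linarith), min_eq_left (by linarith),
      min_eq_left (by linarith), if_neg h.ne]
    ring
  · subst h
    have h2 := hp i hi
    rw [min_self, min_self, min_eq_right h2.le, min_eq_left h2.le, if_pos rfl]
    ring
  · have h1 := partition_mono hp (i := j + 1) (j := i) h hi.le
    have h2 := hp i hi
    have h3 := hp j hj
    rw [min_eq_right (by linarith), min_eq_right (by linarith), min_eq_right (by linarith),
      min_eq_right (by linarith), if_neg h.ne']
    ring

/-- `averageLp n p` is the orthogonal projection onto the step functions of the partition, hence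
realizes the best approximation. -/
theorem norm_averageLp_sub_le (hp : ∀ i < n, (p i : ℝ) < p (i + 1)) (ψ : Lp ℝ 2 (lebesgueOn T))
    {φ : Lp ℝ 2 (lebesgueOn T)}
    (hφ : φ ∈ Submodule.span ℝ (cellLp p '' Iio n)) :
    ‖averageLp n p ψ - ψ‖ ≤ ‖φ - ψ‖ := by
  set U := Submodule.span ℝ (cellLp p '' Iio n) with hU
  have hmem : averageLp n p ψ ∈ U := Submodule.sum_mem _ fun i hi =>
    Submodule.smul_mem _ _ (Submodule.subset_span ⟨i, Finset.mem_range.1 hi, rfl⟩)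
  have horth : ∀ x ∈ U, inner ℝ x (averageLp n p ψ - ψ) = 0 := by
    intro x hx
    induction hx using Submodule.span_induction with
    | mem x hx =>
      obtain ⟨j, hj, rfl⟩ := hx
      have hj' : j < n := hj
      rw [inner_sub_right, averageLp, inner_sum, Finset.sum_eq_single_of_mem j
        (Finset.mem_range.2 hj'), inner_smul_right, inner_cellLp_cellLp hp hj' hj', if_pos rfl,
        inner_cellLp]
      · have : (p (j + 1) : ℝ) - p j ≠ 0 := (sub_pos.2 (hp j hj')).ne'
        field_simp
        ring
      · intro i hi hij
        rw [inner_smul_right, inner_cellLp_cellLp hp hj' (Finset.mem_range.1 hi),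
          if_neg hij.symm, mul_zero]
    | zero => simp
    | add x y _ _ hx hy => rw [inner_add_left, hx, hy, add_zero]
    | smul c x _ hx => rw [inner_smul_left, hx, mul_zero]
  have h := norm_add_sq_eq_norm_sq_add_norm_sq_of_inner_eq_zero _ _
    (horth (φ - averageLp n p ψ) (U.sub_mem hφ hmem))
  rw [sub_add_sub_cancel] at h
  refine abs_le_of_sq_le_sq' ?_ (norm_nonneg _) |>.2
  nlinarith [mul_self_nonneg ‖φ - averageLp n p ψ‖]

theorem stepLp_mem_span (h0 : (p 0 : ℝ) = 0) {i : ℕ} (hi : i ≤ n) :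
    stepLp T (p i) ∈ Submodule.span ℝ (cellLp p '' Iio n) := by
  induction i with
  | zero =>
    have : stepLp T (p 0) = 0 := by
      rw [← inner_self_eq_zero (𝕜 := ℝ), inner_stepLp_stepLp (p 0).2 (p 0).2, h0, min_self]
    rw [this]
    exact Submodule.zero_mem _
  | succ i ih =>
    have h1 : cellLp p i ∈ Submodule.span ℝ (cellLp p '' Iio n) :=
      Submodule.subset_span ⟨i, hi, rfl⟩
    have := Submodule.add_mem _ h1 (ih (by omega))
    rwa [cellLp, sub_add_cancel] at this

theorem exists_stepLp_near (h0 : (p 0 : ℝ) = 0) (hn : (p n : ℝ) = T) {δ : ℝ} (hδ : 0 < δ)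
    (hmesh : ∀ i < n, (p (i + 1) : ℝ) - p i < δ) {t : ℝ} (ht : t ∈ Icc 0 T) :
    ∃ φ ∈ Submodule.span ℝ (cellLp p '' Iio n), ‖φ - stepLp T t‖ ^ 2 ≤ δ := by
  classical
  have hex : ∃ i, i ≤ n ∧ t ≤ p i := ⟨n, le_rfl, by rw [hn]; exact ht.2⟩
  obtain ⟨hi, hti⟩ := Nat.find_spec hex
  set i := Nat.find hex with hidef
  refine ⟨stepLp T (p i), stepLp_mem_span h0 hi, ?_⟩
  have hnear : (p i : ℝ) - t ≤ δ := by
    rcases Nat.eq_zero_or_pos i with hz | hpos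
    · rw [hz, h0]; linarith [ht.1]
    · have hlt : (p (i - 1) : ℝ) < t := by
        by_contra hcon
        exact Nat.find_min hex (m := i - 1) (by omega) ⟨by omega, not_lt.1 hcon⟩
      have hm := hmesh (i - 1) (by omega)
      rw [Nat.sub_add_cancel hpos] at hm
      linarith
  rw [← real_inner_self_eq_norm_sq, inner_sub_left, inner_sub_right, inner_sub_right,
    inner_stepLp_stepLp (p i).2 (p i).2, inner_stepLp_stepLp (p i).2 ht,
    inner_stepLp_stepLp ht (p i).2, inner_stepLp_stepLp ht ht, min_self, min_self,
    min_eq_right hti, min_eq_left hti]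
  linarith

theorem exists_mesh_span_near (hT : 0 ≤ T) (ψ : Lp ℝ 2 (lebesgueOn T)) :
    ∀ ε : ℝ, 0 < ε → ∃ δ : ℝ, 0 < δ ∧ ∀ (n : ℕ) (p : ℕ → Icc (0 : ℝ) T), (p 0 : ℝ) = 0 →
      (p n : ℝ) = T → (∀ i < n, (p (i + 1) : ℝ) - p i < δ) →
      ∃ φ ∈ Submodule.span ℝ (cellLp p '' Iio n), ‖φ - ψ‖ < ε := by
  have hspan : ∀ ψ ∈ Submodule.span ℝ (range fun t : Icc 0 T => stepLp T t),
      ∀ ε : ℝ, 0 < ε → ∃ δ : ℝ, 0 < δ ∧ ∀ (n : ℕ) (p : ℕ → Icc (0 : ℝ) T), (p 0 : ℝ) = 0 →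
      (p n : ℝ) = T → (∀ i < n, (p (i + 1) : ℝ) - p i < δ) →
      ∃ φ ∈ Submodule.span ℝ (cellLp p '' Iio n), ‖φ - ψ‖ < ε := by
    intro ψ hψ
    induction hψ using Submodule.span_induction with
    | mem x hx =>
      obtain ⟨t, rfl⟩ := hx
      intro ε hε
      refine ⟨(ε / 2) ^ 2, by positivity, fun n p h0 hn hmesh => ?_⟩
      obtain ⟨φ, hφ, h⟩ := exists_stepLp_near h0 hn (by positivity) hmesh t.2
      refine ⟨φ, hφ, ?_⟩
      have := abs_le_of_sq_le_sq' h (by positivity) |>.2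
      linarith
    | zero =>
      exact fun ε hε => ⟨1, one_pos, fun n p _ _ _ => ⟨0, Submodule.zero_mem _, by simpa using hε⟩⟩
    | add x y _ _ hx hy =>
      intro ε hε
      obtain ⟨δ₁, hδ₁, h1⟩ := hx (ε / 2) (by positivity)
      obtain ⟨δ₂, hδ₂, h2⟩ := hy (ε / 2) (by positivity)
      refine ⟨min δ₁ δ₂, lt_min hδ₁ hδ₂, fun n p h0 hn hmesh => ?_⟩
      obtain ⟨φ₁, hφ₁, e1⟩ := h1 n p h0 hn fun i hi => (hmesh i hi).trans_le (min_le_left _ _)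
      obtain ⟨φ₂, hφ₂, e2⟩ := h2 n p h0 hn fun i hi => (hmesh i hi).trans_le (min_le_right _ _)
      refine ⟨φ₁ + φ₂, Submodule.add_mem _ hφ₁ hφ₂, ?_⟩
      rw [add_sub_add_comm]
      linarith [norm_add_le (φ₁ - x) (φ₂ - y)]
    | smul c x _ hx =>
      intro ε hε
      obtain ⟨δ, hδ, h⟩ := hx (ε / (|c| + 1)) (by positivity)
      refine ⟨δ, hδ, fun n p h0 hn hmesh => ?_⟩
      obtain ⟨φ, hφ, e⟩ := h n p h0 hn hmesh
      refine ⟨c • φ, Submodule.smul_mem _ _ hφ, ?_⟩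
      rw [← smul_sub, norm_smul, Real.norm_eq_abs]
      rw [lt_div_iff₀ (by positivity)] at e
      nlinarith [norm_nonneg (φ - x), abs_nonneg c]
  intro ε hε
  have hψ : ψ ∈ (Submodule.span ℝ (range fun t : Icc 0 T => stepLp T t)).topologicalClosure := by
    rw [dense_span_stepLp hT]; trivial
  obtain ⟨χ, hχ, hd⟩ := Metric.mem_closure_iff.1 hψ (ε / 2) (by positivity)
  obtain ⟨δ, hδ, h⟩ := hspan χ hχ (ε / 2) (by positivity)
  refine ⟨δ, hδ, fun n p h0 hn hmesh => ?_⟩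
  obtain ⟨φ, hφ, e⟩ := h n p h0 hn hmesh
  refine ⟨φ, hφ, ?_⟩
  rw [dist_eq_norm, norm_sub_rev] at hd
  linarith [norm_sub_le_norm_sub_add_norm_sub φ χ ψ]

/-- The integral against `Y_t = W (K* 𝟙_{[0,t]})` is `ψ ↦ W (K* ψ)`. -/
theorem isFIntegral_of_isometry {Ω : Type*} [MeasurableSpace Ω] {P : Measure Ω}
    {W : Lp ℝ 2 (lebesgueOn T) →L[ℝ] Lp ℝ 2 P} (hW : ∀ φ, ‖W φ‖ = ‖φ‖)
    {A : Lp ℝ 2 (lebesgueOn T) →L[ℝ] Lp ℝ 2 (lebesgueOn T)} {Y : Icc (0 : ℝ) T → Ω → ℝ}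
    (hT : 0 ≤ T) (hY : ∀ t : Icc (0 : ℝ) T, Y t =ᵐ[P] W (A (stepLp T t)))
    (ψ : Lp ℝ 2 (lebesgueOn T)) : IsFIntegral P T Y ψ (W (A ψ)) := by
  refine ⟨Lp.memLp _, fun ε hε => ?_⟩
  obtain ⟨e, he0, heε⟩ := ENNReal.lt_iff_exists_nnreal_btwn.1 hε
  have he0' : 0 < (e : ℝ) := by exact_mod_cast he0
  obtain ⟨δ, hδ, h⟩ := exists_mesh_span_near hT ψ (e / (‖A‖ + 1)) (by positivity)
  refine ⟨δ, hδ, fun n p h0 hn hp hmesh => ?_⟩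
  obtain ⟨φ, hφ, hlt⟩ := h n p h0 hn hmesh
  have hlt' := (norm_averageLp_sub_le hp ψ hφ).trans_lt hlt
  have hae : (fun ω => (∑ i ∈ Finset.range n,
      (1 / ((p (i + 1) : ℝ) - p i) * ∫ s in (p i : ℝ)..(p (i + 1) : ℝ), ψ s) *
        (Y (p (i + 1)) ω - Y (p i) ω)) - W (A ψ) ω) =ᵐ[P]
      (W (A (averageLp n p ψ)) - W (A ψ) : Lp ℝ 2 P) := by
    set a : ℕ → ℝ := fun i =>
      1 / ((p (i + 1) : ℝ) - p i) * ∫ s in (p i : ℝ)..(p (i + 1) : ℝ), ψ s with ha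
    have e0 : W (A (averageLp n p ψ)) = ∑ i ∈ Finset.range n,
        a i • (W (A (stepLp T (p (i + 1)))) - W (A (stepLp T (p i)))) := by
      simp only [averageLp, cellLp, map_sum, map_smul, map_sub, ha]
    have e1 : ∀ᵐ ω ∂P, ∀ i, (a i • (W (A (stepLp T (p (i + 1)))) - W (A (stepLp T (p i)))) :
        Lp ℝ 2 P) ω = a i * (Y (p (i + 1)) ω - Y (p i) ω) := by
      refine ae_all_iff.2 fun i => ?_
      filter_upwards [Lp.coeFn_smul (a i) (W (A (stepLp T (p (i + 1)))) - W (A (stepLp T (p i)))),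
        Lp.coeFn_sub (W (A (stepLp T (p (i + 1))))) (W (A (stepLp T (p i)))), hY (p i),
        hY (p (i + 1))] with s e1 e2 e3 e4
      rw [e1, Pi.smul_apply, e2, Pi.sub_apply, e3, e4, smul_eq_mul]
    rw [e0]
    filter_upwards [e1, Lp.coeFn_sub (∑ i ∈ Finset.range n,
        a i • (W (A (stepLp T (p (i + 1)))) - W (A (stepLp T (p i))))) (W (A ψ)),
      Lp.coeFn_finsetSum (Finset.range n)
      fun i => a i • (W (A (stepLp T (p (i + 1)))) - W (A (stepLp T (p i))))] with s e1 e2 e4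
    rw [e2, Pi.sub_apply, e4, Finset.sum_apply]
    simp only [e1]
    rfl
  rw [eLpNorm_congr_ae hae, ← map_sub, ← map_sub, ← Lp.enorm_def, ← ofReal_norm, hW]
  refine lt_of_le_of_lt ?_ heε
  rw [← ENNReal.ofReal_coe_nnreal]
  refine ENNReal.ofReal_le_ofReal ?_
  rw [lt_div_iff₀ (by positivity)] at hlt'
  nlinarith [A.le_opNorm (averageLp n p ψ - ψ), norm_nonneg (averageLp n p ψ - ψ), norm_nonneg A]

end Averaging

/-! ### Gaussian shifts and integration by parts in finite dimension -/

theorem abs_exp_sub_one_le (y : ℝ) : |Real.exp y - 1| ≤ |y| * Real.exp |y| := by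
  rcases le_total 0 y with hy | hy
  · rw [abs_of_nonneg hy, abs_of_nonneg (by linarith [Real.add_one_le_exp y])]
    have h1 := Real.add_one_le_exp (-y)
    have h2 : Real.exp (-y) * Real.exp y = 1 := by rw [← Real.exp_add]; simp
    nlinarith [Real.exp_pos y]
  · rw [abs_of_nonpos hy, abs_of_nonpos (by linarith [Real.exp_le_one_iff.2 hy])]
    have h1 := Real.add_one_le_exp y
    have h2 := Real.add_one_le_exp (-y)
    nlinarith

theorem abs_exp_div_le {ε z v : ℝ} (hv : 0 ≤ v) (h0 : ε ≠ 0) (h1 : |ε| ≤ 1) :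
    |(Real.exp (ε * z - ε ^ 2 * v / 2) - 1) / ε| ≤
      Real.exp (2 * v) * (Real.exp (2 * z) + Real.exp (-2 * z)) := by
  have hε : 0 < |ε| := abs_pos.2 h0
  set q := |z| + v with hq
  have hq0 : 0 ≤ q := by positivity
  have hy : |ε * z - ε ^ 2 * v / 2| ≤ |ε| * q := by
    refine (abs_sub _ _).trans ?_
    rw [abs_mul, abs_of_nonneg (by positivity : 0 ≤ ε ^ 2 * v / 2), ← sq_abs ε]
    have : |ε| ^ 2 * v ≤ |ε| * v := by
      rw [sq, mul_assoc]
      exact mul_le_of_le_one_left (by positivity) h1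
    have : 0 ≤ |ε| * v := by positivity
    rw [hq]
    nlinarith
  have hy' : |ε * z - ε ^ 2 * v / 2| ≤ q := hy.trans (mul_le_of_le_one_left hq0 h1)
  rw [abs_div, div_le_iff₀ hε]
  have e1 : Real.exp (2 * |z|) ≤ Real.exp (2 * z) + Real.exp (-2 * z) := by
    rcases abs_cases z with ⟨h, -⟩ | ⟨h, -⟩ <;> rw [h]
    · linarith [Real.exp_pos (-2 * z)]
    · have : 2 * -z = -2 * z := by ring
      rw [this]
      linarith [Real.exp_pos (2 * z)]
  calc |Real.exp (ε * z - ε ^ 2 * v / 2) - 1| ≤ _ := abs_exp_sub_one_le _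
    _ ≤ (|ε| * q) * Real.exp q := by gcongr
    _ ≤ (|ε| * Real.exp q) * Real.exp q := by
        gcongr
        linarith [Real.add_one_le_exp q]
    _ = Real.exp (2 * v) * Real.exp (2 * |z|) * |ε| := by
        have : Real.exp (2 * v) * Real.exp (2 * |z|) = Real.exp q * Real.exp q := by
          rw [← Real.exp_add, ← Real.exp_add, hq]
          congr 1
          ring
        rw [this]
        ring
    _ ≤ _ := by gcongr

theorem tendsto_exp_div (z v : ℝ) :
    Tendsto (fun ε : ℝ => (Real.exp (ε * z - ε ^ 2 * v / 2) - 1) / ε) (𝓝[≠] 0) (𝓝 z) := by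
  have h : HasDerivAt (fun ε : ℝ => Real.exp (ε * z - ε ^ 2 * v / 2)) z 0 := by
    have h1 : HasDerivAt (fun ε : ℝ => ε * z - ε ^ 2 * v / 2) z 0 := by
      have := ((hasDerivAt_id (0 : ℝ)).mul_const z).sub
        ((((hasDerivAt_id (0 : ℝ)).pow 2).mul_const v).div_const 2)
      simpa using! this
    simpa using h1.exp
  refine (hasDerivAt_iff_tendsto_slope_zero.1 h).congr fun ε => ?_
  simp [div_eq_inv_mul]

section Quotient

variable {E : Type*} [NormedAddCommGroup E] [NormedSpace ℝ E]

theorem abs_quotient_le {g : E → ℝ} {L : ℝ≥0} (hg : LipschitzWith L g) (x c : E) (ε : ℝ) :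
    |(g (x + ε • c) - g x) / ε| ≤ L * ‖c‖ := by
  rcases eq_or_ne ε 0 with rfl | hε
  · simp; positivity
  · rw [abs_div, div_le_iff₀ (abs_pos.2 hε)]
    have := hg.dist_le_mul (x + ε • c) x
    rw [dist_eq_norm, dist_eq_norm, add_sub_cancel_left, norm_smul, Real.norm_eq_abs,
      Real.norm_eq_abs] at this
    linarith

theorem tendsto_quotient {g : E → ℝ} {x c : E} (h : LineDifferentiableAt ℝ g x c) :
    Tendsto (fun ε : ℝ => (g (x + ε • c) - g x) / ε) (𝓝[≠] 0) (𝓝 (lineDeriv ℝ g x c)) := by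
  refine (hasDerivAt_iff_tendsto_slope_zero.1 h.hasLineDerivAt).congr fun ε => ?_
  simp [div_eq_inv_mul]

theorem abs_lineDeriv_le {g : E → ℝ} {L : ℝ≥0} (hg : LipschitzWith L g) (x c : E) :
    |lineDeriv ℝ g x c| ≤ L * ‖c‖ := norm_lineDeriv_le_of_lipschitz ℝ hg

end Quotient

section GaussianShift

theorem lintegral_gaussianReal_shift (v : ℝ≥0) (s : ℝ) {h : ℝ → ℝ≥0∞} (hh : Measurable h) :
    ∫⁻ z, h (z + s * v) ∂(gaussianReal 0 v) =
      ∫⁻ z, h z * ENNReal.ofReal (Real.exp (s * z - s ^ 2 * v / 2)) ∂(gaussianReal 0 v) := by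
  rcases eq_or_ne v 0 with rfl | hv
  · have hm : Measurable fun z => h z * ENNReal.ofReal (Real.exp (s * z - s ^ 2 * (0 : ℝ≥0) / 2)) := by
      fun_prop
    rw [gaussianReal_zero_var, lintegral_dirac' _ (by fun_prop), lintegral_dirac' _ hm]
    simp
  · have h1 : ∫⁻ z, h (z + s * v) ∂(gaussianReal 0 v) =
        ∫⁻ z, h z ∂(gaussianReal (0 + s * v) v) := by
      rw [← gaussianReal_map_add_const, lintegral_map hh (by fun_prop)]
    rw [h1, gaussianReal_of_var_ne_zero _ hv, gaussianReal_of_var_ne_zero _ hv,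
      lintegral_withDensity_eq_lintegral_mul _ (measurable_gaussianPDF _ _) hh,
      lintegral_withDensity_eq_lintegral_mul _ (measurable_gaussianPDF _ _) (by fun_prop)]
    refine lintegral_congr fun z => ?_
    simp only [Pi.mul_apply]
    have h2 : gaussianPDF (0 + s * v) v z =
        gaussianPDF 0 v z * ENNReal.ofReal (Real.exp (s * z - s ^ 2 * v / 2)) := by
      rw [gaussianPDF, gaussianPDF, ← ENNReal.ofReal_mul (gaussianPDFReal_nonneg _ _ _),
        gaussianPDFReal, gaussianPDFReal, mul_assoc (√(2 * Real.pi * v))⁻¹, ← Real.exp_add]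
      congr 3
      have : (v : ℝ) ≠ 0 := by exact_mod_cast hv
      field_simp
      ring
    rw [h2]
    ring

variable {Ω E : Type*} [MeasurableSpace Ω] {P : Measure Ω} [IsProbabilityMeasure P]
  [NormedAddCommGroup E] [NormedSpace ℝ E] [MeasurableSpace E] [BorelSpace E]
  [SecondCountableTopology E]
  {X Y : Ω → E} {Z : Ω → ℝ} {v : ℝ≥0} {d : E}

/-- The Cameron–Martin formula for a vector `X = Y + Z d`, with `Z` centered Gaussian of variance
`v` and independent of `Y`: a shift of `X` by a multiple of `v d` amounts to a shift of `Z`. -/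
theorem lintegral_cameronMartin_shift (hY : AEMeasurable Y P) (hZ : AEMeasurable Z P)
    (hind : IndepFun Y Z P) (hlaw : P.map Z = gaussianReal 0 v)
    (hX : X =ᵐ[P] fun ω => Y ω + Z ω • d) (s : ℝ) {h : E → ℝ≥0∞} (hh : Measurable h) :
    ∫⁻ ω, h (X ω + s • (v : ℝ) • d) ∂P =
      ∫⁻ ω, h (X ω) * ENNReal.ofReal (Real.exp (s * Z ω - s ^ 2 * v / 2)) ∂P := by
  have hprod := (indepFun_iff_map_prod_eq_prod_map_map hY hZ).1 hind
  rw [hlaw] at hprod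
  have : IsProbabilityMeasure (P.map Y) := Measure.isProbabilityMeasure_map hY
  have m1 : Measurable fun p : E × ℝ => h (p.1 + (p.2 + s * v) • d) := by fun_prop
  have m2 : Measurable fun p : E × ℝ => h (p.1 + p.2 • d) *
      ENNReal.ofReal (Real.exp (s * p.2 - s ^ 2 * v / 2)) := by fun_prop
  calc ∫⁻ ω, h (X ω + s • (v : ℝ) • d) ∂P
      = ∫⁻ ω, h (Y ω + (Z ω + s * v) • d) ∂P := by
        refine lintegral_congr_ae ?_
        filter_upwards [hX] with ω hω
        rw [hω, add_smul, smul_smul, add_assoc]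
    _ = ∫⁻ p, h (p.1 + (p.2 + s * v) • d) ∂((P.map Y).prod (gaussianReal 0 v)) := by
        rw [← hprod, lintegral_map' m1.aemeasurable (hY.prodMk hZ)]
    _ = ∫⁻ p, h (p.1 + p.2 • d) * ENNReal.ofReal (Real.exp (s * p.2 - s ^ 2 * v / 2))
          ∂((P.map Y).prod (gaussianReal 0 v)) := by
        rw [lintegral_prod _ m1.aemeasurable, lintegral_prod _ m2.aemeasurable]
        refine lintegral_congr fun y => ?_
        exact lintegral_gaussianReal_shift v s (h := fun z => h (y + z • d)) (by fun_prop)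
    _ = ∫⁻ ω, h (Y ω + Z ω • d) * ENNReal.ofReal (Real.exp (s * Z ω - s ^ 2 * v / 2)) ∂P := by
        rw [← hprod, lintegral_map' m2.aemeasurable (hY.prodMk hZ)]
    _ = _ := by
        refine lintegral_congr_ae ?_
        filter_upwards [hX] with ω hω
        rw [hω]

theorem integral_cameronMartin_shift (hY : AEMeasurable Y P) (hZ : AEMeasurable Z P)
    (hind : IndepFun Y Z P) (hlaw : P.map Z = gaussianReal 0 v)
    (hX : X =ᵐ[P] fun ω => Y ω + Z ω • d) (s : ℝ) {g : E → ℝ} (hg : Continuous g) :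
    ∫ ω, g (X ω + s • (v : ℝ) • d) ∂P =
      ∫ ω, g (X ω) * Real.exp (s * Z ω - s ^ 2 * v / 2) ∂P := by
  have hXm : AEMeasurable X P := (hY.add (hZ.smul_const d)).congr hX.symm
  set ρ : Ω → ℝ≥0∞ := fun ω => ENNReal.ofReal (Real.exp (s * Z ω - s ^ 2 * v / 2)) with hρ
  have hρm : AEMeasurable ρ P := by fun_prop
  have hac := withDensity_absolutelyContinuous P ρ
  have hmap : P.map (fun ω => X ω + s • (v : ℝ) • d) = (P.withDensity ρ).map X := by
    refine Measure.ext_of_lintegral _ fun h hh => ?_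
    have hhX : AEMeasurable (fun ω => h (X ω)) P := hh.comp_aemeasurable hXm
    rw [lintegral_map' hh.aemeasurable (by fun_prop), lintegral_map' hh.aemeasurable
      (hXm.mono_ac hac), lintegral_withDensity_eq_lintegral_mul₀ hρm hhX,
      lintegral_cameronMartin_shift hY hZ hind hlaw hX s hh]
    simp only [Pi.mul_apply, mul_comm, hρ]
  have h1 := integral_map (μ := P) (φ := fun ω => X ω + s • (v : ℝ) • d) (by fun_prop)
    (hg.aestronglyMeasurable (μ := P.map fun ω => X ω + s • (v : ℝ) • d))
  rw [← h1, hmap, integral_map (hXm.mono_ac hac) hg.aestronglyMeasurable,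
    integral_withDensity_eq_integral_toReal_smul₀ hρm (by simp [hρ])]
  refine integral_congr_ae (Eventually.of_forall fun ω => ?_)
  simp only [hρ, smul_eq_mul, ENNReal.toReal_ofReal (Real.exp_pos _).le, mul_comm]

/-- A Lipschitz function is differentiable along the Cameron–Martin direction at almost every point
for the law of `X`, which may be degenerate: almost all the shifts of `X` avoid the exceptional set,
and by the Cameron–Martin formula one such shift is enough. -/
theorem ae_lineDifferentiableAt (hY : AEMeasurable Y P) (hZ : AEMeasurable Z P)
    (hind : IndepFun Y Z P) (hlaw : P.map Z = gaussianReal 0 v)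
    (hX : X =ᵐ[P] fun ω => Y ω + Z ω • d) {g : E → ℝ} {L : ℝ≥0} (hg : LipschitzWith L g) :
    ∀ᵐ ω ∂P, LineDifferentiableAt ℝ g (X ω) ((v : ℝ) • d) := by
  have hXm : AEMeasurable X P := (hY.add (hZ.smul_const d)).congr hX.symm
  set c := (v : ℝ) • d with hc
  set N : Set E := {x | LineDifferentiableAt ℝ g x c}ᶜ with hN
  have hNm : MeasurableSet N := (measurableSet_lineDifferentiableAt hg.continuous).compl
  have hind1 : Measurable (N.indicator (1 : E → ℝ≥0∞)) := measurable_one.indicator hNm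
  have hline : ∀ x : E, ∫⁻ s : ℝ, N.indicator 1 (x + s • c) = 0 := by
    intro x
    have hl : LipschitzWith (L * ‖c‖₊) fun s : ℝ => g (x + s • c) := by
      refine LipschitzWith.of_dist_le_mul fun s t => ?_
      refine (hg.dist_le_mul _ _).trans_eq ?_
      rw [dist_add_left, dist_eq_norm, ← sub_smul, norm_smul, dist_eq_norm]
      push_cast
      ring
    rw [lintegral_eq_zero_iff (by fun_prop)]
    filter_upwards [hl.ae_differentiableAt_real] with s hs
    refine indicator_of_notMem (not_not.2 ?_) _
    have h2 : DifferentiableAt ℝ (fun r : ℝ => g (x + r • c)) (s + 0) := by rwa [add_zero]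
    have h3 : DifferentiableAt ℝ (fun r : ℝ => s + r) 0 := differentiableAt_id.const_add _
    refine (h2.comp 0 h3).congr_of_eventuallyEq (Eventually.of_forall fun r => ?_)
    simp only [Function.comp_apply, add_smul, add_assoc]
  have hm : AEMeasurable (Function.uncurry fun (s : ℝ) (ω : Ω) =>
      N.indicator (1 : E → ℝ≥0∞) (X ω + s • c)) (volume.prod P) := by
    refine hind1.comp_aemeasurable (AEMeasurable.add hXm.comp_snd ?_)
    exact (measurable_fst.smul_const c).aemeasurable
  have hswap : ∫⁻ s : ℝ, ∫⁻ ω, N.indicator 1 (X ω + s • c) ∂P = 0 := by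
    rw [lintegral_lintegral_swap hm]
    simp only [hline, lintegral_zero]
  have hm2 : AEMeasurable (fun s : ℝ => ∫⁻ ω, N.indicator (1 : E → ℝ≥0∞) (X ω + s • c) ∂P) :=
    hm.lintegral_prod_right'
  rw [lintegral_eq_zero_iff' hm2] at hswap
  obtain ⟨s, hs⟩ := hswap.exists
  change ∫⁻ ω, N.indicator 1 (X ω + s • (v : ℝ) • d) ∂P = 0 at hs
  have hm3 : AEMeasurable (fun ω => N.indicator (1 : E → ℝ≥0∞) (X ω) *
      ENNReal.ofReal (Real.exp (s * Z ω - s ^ 2 * v / 2))) P :=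
    (hind1.comp_aemeasurable hXm).mul (by fun_prop)
  rw [lintegral_cameronMartin_shift hY hZ hind hlaw hX s hind1, lintegral_eq_zero_iff' hm3] at hs
  filter_upwards [hs] with ω hω
  by_contra hcon
  rw [indicator_of_mem (show X ω ∈ N from hcon)] at hω
  simp at hω
  exact absurd hω (not_le.2 (Real.exp_pos _))

theorem tendsto_eLpNorm_quotient (hY : AEMeasurable Y P) (hZ : AEMeasurable Z P)
    (hind : IndepFun Y Z P) (hlaw : P.map Z = gaussianReal 0 v)
    (hX : X =ᵐ[P] fun ω => Y ω + Z ω • d) {g : E → ℝ} {L : ℝ≥0} (hg : LipschitzWith L g)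
    {c : E} (hc : c = (v : ℝ) • d) :
    Tendsto (fun ε : ℝ => eLpNorm (fun ω => (g (X ω + ε • c) - g (X ω)) / ε -
      lineDeriv ℝ g (X ω) c) 2 P) (𝓝[≠] 0) (𝓝 0) := by
  have hXm : AEMeasurable X P := (hY.add (hZ.smul_const d)).congr hX.symm
  have hgm : Measurable g := hg.continuous.measurable
  have hDm : Measurable fun x => lineDeriv ℝ g x c := measurable_lineDeriv hg.continuous
  have h1 : Tendsto (fun ε : ℝ => ∫⁻ ω, ‖(g (X ω + ε • c) - g (X ω)) / ε -
      lineDeriv ℝ g (X ω) c‖ₑ ^ 2 ∂P) (𝓝[≠] 0) (𝓝 (∫⁻ _, 0 ∂P)) := by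
    refine tendsto_lintegral_filter_of_dominated_convergence'
      (fun _ => ENNReal.ofReal (2 * (L * ‖c‖)) ^ 2) (Eventually.of_forall fun ε => ?_)
      (Eventually.of_forall fun ε => Eventually.of_forall fun ω => ?_) ?_ ?_
    · have hm : Measurable fun x => ‖(g (x + ε • c) - g x) / ε - lineDeriv ℝ g x c‖ₑ ^ 2 := by
        fun_prop
      exact hm.comp_aemeasurable hXm
    · gcongr
      rw [Real.enorm_eq_ofReal_abs]
      refine ENNReal.ofReal_le_ofReal ((abs_sub _ _).trans ?_)
      linarith [abs_quotient_le hg (X ω) c ε, abs_lineDeriv_le hg (X ω) c]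
    · rw [lintegral_const, measure_univ, mul_one]
      exact ENNReal.pow_ne_top ENNReal.ofReal_ne_top
    · filter_upwards [ae_lineDifferentiableAt hY hZ hind hlaw hX hg] with ω hω
      rw [← hc] at hω
      have h2 := ((tendsto_quotient hω).sub_const (lineDeriv ℝ g (X ω) c)).enorm
      simpa using ENNReal.Tendsto.pow (n := 2) h2
  simp only [← eLpNorm_two_sq, lintegral_zero] at h1
  have h3 := h1.ennrpow_const (1 / 2)
  have e : ∀ a : ℝ≥0∞, (a ^ 2) ^ (1 / 2 : ℝ) = a := fun a => by
    rw [← ENNReal.rpow_natCast, ← ENNReal.rpow_mul]; norm_num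
  simp only [e] at h3
  simpa using h3

/-- Gaussian integration by parts: the derivative at `s = 0` of the Cameron–Martin formula. -/
theorem integral_lineDeriv_eq (hY : AEMeasurable Y P) (hZ : AEMeasurable Z P)
    (hind : IndepFun Y Z P) (hlaw : P.map Z = gaussianReal 0 v)
    (hX : X =ᵐ[P] fun ω => Y ω + Z ω • d) {g : E → ℝ} {L : ℝ≥0} (hg : LipschitzWith L g)
    {C : ℝ} (hC : ∀ x, |g x| ≤ C) {c : E} (hc : c = (v : ℝ) • d) :
    ∫ ω, lineDeriv ℝ g (X ω) c ∂P = ∫ ω, g (X ω) * Z ω ∂P := by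
  have hXm : AEMeasurable X P := (hY.add (hZ.smul_const d)).congr hX.symm
  have hgc := hg.continuous
  have hgm : Measurable g := hgc.measurable
  have hgi : ∀ (x : Ω → E), AEMeasurable x P → Integrable (fun ω => g (x ω)) P := fun x hx =>
    Integrable.of_bound (hgm.comp_aemeasurable hx).aestronglyMeasurable C
      (Eventually.of_forall fun ω => hC _)
  have hexp : ∀ a : ℝ, Integrable (fun ω => Real.exp (a * Z ω)) P := fun a => by
    have := integrable_exp_mul_gaussianReal (μ := 0) (v := v) a
    rw [← hlaw] at this
    exact this.comp_aemeasurable hZ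
  have hdom : Integrable (fun ω => C * (Real.exp (2 * v) *
      (Real.exp (2 * Z ω) + Real.exp (-2 * Z ω)))) P :=
    (((hexp 2).add (hexp (-2))).const_mul _).const_mul _
  have hl : Tendsto (fun ε : ℝ => ∫ ω, (g (X ω + ε • c) - g (X ω)) / ε ∂P) (𝓝[≠] 0)
      (𝓝 (∫ ω, lineDeriv ℝ g (X ω) c ∂P)) := by
    refine tendsto_integral_filter_of_dominated_convergence (fun _ => L * ‖c‖)
      (Eventually.of_forall fun ε => ?_)
      (Eventually.of_forall fun ε => Eventually.of_forall fun ω => abs_quotient_le hg (X ω) c ε)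
      (integrable_const _) ?_
    · have hm : Measurable fun x => (g (x + ε • c) - g x) / ε := by fun_prop
      exact (hm.comp_aemeasurable hXm).aestronglyMeasurable
    · filter_upwards [ae_lineDifferentiableAt hY hZ hind hlaw hX hg] with ω hω
      rw [← hc] at hω
      exact tendsto_quotient hω
  have hr : Tendsto (fun ε : ℝ => ∫ ω, g (X ω) *
      ((Real.exp (ε * Z ω - ε ^ 2 * v / 2) - 1) / ε) ∂P) (𝓝[≠] 0)
      (𝓝 (∫ ω, g (X ω) * Z ω ∂P)) := by
    refine tendsto_integral_filter_of_dominated_convergence _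
      (Eventually.of_forall fun ε => ?_) ?_ hdom
      (Eventually.of_forall fun ω => (tendsto_exp_div (Z ω) v).const_mul _)
    · exact AEMeasurable.aestronglyMeasurable (by fun_prop)
    · have hball : ∀ᶠ ε : ℝ in 𝓝[≠] 0, |ε| ≤ 1 := by
        refine eventually_nhdsWithin_of_eventually_nhds ?_
        filter_upwards [Metric.ball_mem_nhds (0 : ℝ) one_pos] with ε hε
        rw [Metric.mem_ball, dist_zero_right, Real.norm_eq_abs] at hε
        exact hε.le
      filter_upwards [hball, self_mem_nhdsWithin] with ε h1 h0
      refine Eventually.of_forall fun ω => ?_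
      rw [norm_mul, Real.norm_eq_abs, Real.norm_eq_abs]
      exact mul_le_mul (hC _) (abs_exp_div_le v.2 h0 h1) (abs_nonneg _)
        ((abs_nonneg _).trans (hC 0))
  refine tendsto_nhds_unique hl (hr.congr' ?_)
  filter_upwards [self_mem_nhdsWithin] with ε h0
  have hgexp : Integrable (fun ω => g (X ω) * Real.exp (ε * Z ω - ε ^ 2 * v / 2)) P := by
    simp only [Real.exp_sub, div_eq_mul_inv]
    exact ((hexp ε).mul_const _).bdd_mul (hgm.comp_aemeasurable hXm).aestronglyMeasurable
      (Eventually.of_forall fun ω => hC _)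
  simp only [← mul_div_assoc, mul_sub, mul_one]
  rw [integral_div, integral_div, integral_sub hgexp (hgi X hXm),
    integral_sub (hgi _ (by fun_prop)) (hgi X hXm), hc,
    integral_cameronMartin_shift hY hZ hind hlaw hX ε hgc]

end GaussianShift

/-! ### The integration by parts formula -/

section Assembly

variable {Ω : Type*} [MeasurableSpace Ω] {P : Measure Ω} [IsProbabilityMeasure P] {T : ℝ}

theorem opK_eq_mul {F Fhat : ℝ → ℝ → ℝ} {f : ℝ → ℝ}
    (hF : ∀ t s, 0 ≤ s → s ≤ t → t ≤ T → F t s = f t * Fhat t s) (u : ℝ → ℝ) {t : ℝ}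
    (ht : t ∈ Icc 0 T) : opK F u t = f t * opK Fhat u t := by
  rw [opK, opK, ← intervalIntegral.integral_const_mul]
  refine intervalIntegral.integral_congr fun s hs => ?_
  rw [uIcc_of_le ht.1] at hs
  simp only [hF t s hs.1 hs.2 ht.2, mul_assoc]

/-- `R ψ = k / f` has the unique solution `ψ = (K*)⁻¹ u`, for `k = K_F u`. -/
theorem isRInverse_iff (hT : 0 < T) {F Fhat : ℝ → ℝ → ℝ} {f : ℝ → ℝ}
    (hf_ne : ∀ᵐ t ∂(lebesgueOn T), f t ≠ 0)
    (hF : ∀ t s, 0 ≤ s → s ≤ t → t ≤ T → F t s = f t * Fhat t s)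
    {A : Lp ℝ 2 (lebesgueOn T) →L[ℝ] Lp ℝ 2 (lebesgueOn T)} (hbij : Function.Bijective A)
    (hA : ∀ g, A g =ᵐ[lebesgueOn T] opKStar T Fhat g)
    (hstep : ∀ t ∈ Icc 0 T, A (stepLp T t) =ᵐ[lebesgueOn T] (Iic t).indicator (Fhat t))
    {k : PathSpace T} {u : ℝ → ℝ} (hu : MemLp u 2 (lebesgueOn T))
    (hk : ∀ t : Icc (0 : ℝ) T, k t = opK F u t) (ψ : Lp ℝ 2 (lebesgueOn T)) :
    IsRInverse T Fhat (fun t => k t / f t) ψ ↔ A ψ = hu.toLp u := by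
  have hval : ∀ᵐ t ∂(lebesgueOn T), ∀ ht : t ∈ Icc (0 : ℝ) T,
      k ⟨t, ht⟩ / f t = inner ℝ (A (stepLp T t)) (hu.toLp u) := by
    filter_upwards [hf_ne] with t h0 ht
    rw [hk, opK_eq_mul hF u ht, inner_eq_opK ht (hstep t ht) hu.coeFn_toLp]
    field_simp
  have hiff : IsRInverse T Fhat (fun t => k t / f t) ψ ↔
      ∀ᵐ t ∂(lebesgueOn T), inner ℝ (A (stepLp T t)) (A ψ - hu.toLp u) = 0 := by
    rw [ae_restrict_iff' measurableSet_Icc] at hval ⊢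
    refine eventually_congr ?_
    filter_upwards [hval] with t hval
    refine forall_congr' fun ht => ?_
    rw [opR_eq_inner hA hstep ht, hval ht ht, inner_sub_right, sub_eq_zero]
  rw [hiff, ← sub_eq_zero]
  exact ⟨eq_zero_of_ae_opK_eq_zero hT hbij.surjective,
    fun h => Eventually.of_forall fun t => by rw [h, inner_zero_right]⟩

/-- The evaluations of a Gaussian path at finitely many times, decomposed along the Wiener integral
`W u`: the direction is the vector of covariances, and the remainder is independent of `W u`. -/
theorem exists_orthogonal_decomposition
    {W : Lp ℝ 2 (lebesgueOn T) →L[ℝ] Lp ℝ 2 P} (hW : ∀ φ, ‖W φ‖ = ‖φ‖)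
    (hWc : ∀ φ, ∫ ω, Complex.exp (W φ ω * Complex.I) ∂P = Complex.exp (-(‖φ‖ ^ 2 / 2 : ℝ)))
    {m : ℕ} {X : Ω → Fin m → ℝ} {φ : Fin m → Lp ℝ 2 (lebesgueOn T)}
    (hX : ∀ i, (fun ω => X ω i) =ᵐ[P] W (φ i)) (u : Lp ℝ 2 (lebesgueOn T)) :
    ∃ (Y : Ω → Fin m → ℝ) (d : Fin m → ℝ), AEMeasurable Y P ∧ IndepFun Y (W u) P ∧
      (X =ᵐ[P] fun ω => Y ω + W u ω • d) ∧
      (fun i => inner ℝ (φ i) u) = ((‖u‖₊ ^ 2 : ℝ≥0) : ℝ) • d := by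
  set d : Fin m → ℝ := fun i => inner ℝ (φ i) u / ‖u‖ ^ 2 with hd
  have hdu : ∀ i, d i * ‖u‖ ^ 2 = inner ℝ (φ i) u := by
    intro i
    rcases eq_or_ne u 0 with rfl | h0
    · simp
    · have : ‖u‖ ≠ 0 := norm_ne_zero_iff.2 h0
      simp only [hd]
      field_simp
  refine ⟨fun ω i => W (φ i - d i • u) ω, d,
    aemeasurable_pi_lambda _ fun i => (Lp.memLp _).1.aemeasurable,
    indepFun_wiener hW hWc _ u fun i => ?_, ?_, ?_⟩
  · rw [inner_sub_left, real_inner_smul_left, real_inner_self_eq_norm_sq, hdu, sub_self]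
  · have h1 : ∀ᵐ ω ∂P, ∀ i, X ω i = W (φ i - d i • u) ω + W u ω * d i := by
      refine ae_all_iff.2 fun i => ?_
      rw [map_sub, map_smul]
      filter_upwards [hX i, Lp.coeFn_sub (W (φ i)) (d i • W u), Lp.coeFn_smul (d i) (W u)]
        with ω h1 h2 h3
      rw [h1, h2, Pi.sub_apply, h3, Pi.smul_apply, smul_eq_mul]
      ring
    filter_upwards [h1] with ω h
    ext i
    rw [h i]
    rfl
  · ext i
    rw [← hdu i]
    simp [mul_comm]

end Assembly

end VolterraGaussian

open VolterraGaussian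

theorem theorem4p3 {Ω : Type*} [MeasurableSpace Ω] (P : Measure Ω) [IsProbabilityMeasure P]
    (B : ℝ≥0 → Ω → ℝ) (hB : IsBrownianReal B P)
    (T : ℝ) (hT : 0 < T)
    (F Fhat : ℝ → ℝ → ℝ) (f : ℝ → ℝ)
    (hf : MemLp f 2 (lebesgueOn T))
    (hf_ne : ∀ᵐ t ∂(lebesgueOn T), f t ≠ 0)
    (hf_inv : MemLp (fun t => 1 / f t) 2 (lebesgueOn T))
    (hF : ∀ t s, 0 ≤ s → s ≤ t → t ≤ T → F t s = f t * Fhat t s)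
    (hA1 : CondA1 T Fhat) (hA4 : CondA4 T Fhat)
    (BF : Ω → PathSpace T) (hBF_meas : AEMeasurable BF P)
    (hBF : IsFGaussian P B T F (fun t ω => BF ω t))
    (BFhat : Icc (0 : ℝ) T → Ω → ℝ) (hBFhat : IsFGaussian P B T Fhat BFhat)
    (k : PathSpace T) (hk : k ∈ cameronMartin T F)
    (G : PathSpace T → ℝ) (hG : IsLipCylinder T G) :
    ∃ ψ : Lp ℝ 2 (lebesgueOn T),
      IsRInverse T Fhat (fun t => k t / f t) ψ ∧
      (∀ ψ' : Lp ℝ 2 (lebesgueOn T), IsRInverse T Fhat (fun t => k t / f t) ψ' → ψ' = ψ) ∧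
      ∃ (β : Ω → ℝ) (D : PathSpace T → ℝ),
        IsFIntegral P T BFhat ψ β ∧
        IsDirDeriv (P.map BF) k G D ∧
        Integrable (fun ω => D (BF ω)) P ∧
        Integrable (fun ω => G (BF ω) * β ω) P ∧
        ∫ ω, D (BF ω) ∂P = ∫ ω, G (BF ω) * β ω ∂P := by
  obtain ⟨A, hbij, hA, hstep⟩ := exists_starOp hA1 hA4
  obtain ⟨W, hW, hWB, hWc⟩ := exists_wienerIsometry hB.toIsPreBrownianReal hT.le
  obtain ⟨u, hu, hku⟩ := hk
  obtain ⟨m, t, g, -, -, -, ⟨L, hg⟩, ⟨C, hC⟩, hGg⟩ := hG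
  obtain ⟨ψ, hψ⟩ := hbij.surjective (hu.toLp u)
  have hiff := isRInverse_iff hT hf_ne hF hbij hA hstep hu hku
  -- the class of `F(t,·) 𝟙_{[0,t]}`, whose Wiener integral is `BF · t`
  have hmem : ∀ i, MemLp ((Iic (t i : ℝ)).indicator (F (t i))) 2 (lebesgueOn T) := fun i => by
    rw [memLp_indicator_iff_restrict measurableSet_Iic, lebesgueOn_restrict_Iic (t i).2.2]
    exact (hBF (t i)).1
  set φ : Fin m → Lp ℝ 2 (lebesgueOn T) := fun i => (hmem i).toLp with hφ
  set X : Ω → Fin m → ℝ := fun ω i => BF ω (t i) with hX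
  have hXφ : ∀ i, (fun ω => X ω i) =ᵐ[P] W (φ i) := fun i =>
    IsWienerIntegral.ae_eq hW hWB (t i).2 (hBF (t i)) (hmem i).coeFn_toLp
  set Z := W (hu.toLp u) with hZ
  set c : Fin m → ℝ := fun i => k (t i) with hc
  obtain ⟨Y, d, hY, hind, hXY, hdc⟩ := exists_orthogonal_decomposition hW hWc hXφ (hu.toLp u)
  have hcd : c = ((‖hu.toLp u‖₊ ^ 2 : ℝ≥0) : ℝ) • d := by
    rw [← hdc]
    ext i
    rw [hφ, inner_eq_opK (t i).2 (hmem i).coeFn_toLp hu.coeFn_toLp, ← hku]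
  have hlaw := map_wiener_eq_gaussianReal hWc (hu.toLp u)
  have hZm : AEMeasurable Z P := (Lp.memLp Z).1.aemeasurable
  have hev : Continuous fun γ : PathSpace T => fun i => γ (t i) := by fun_prop
  have hGc : Continuous G := by
    rw [show G = fun γ => g fun i => γ (t i) from funext hGg]
    exact hg.continuous.comp hev
  set D : PathSpace T → ℝ := fun γ => lineDeriv ℝ g (fun i => γ (t i)) c with hD
  have hDm : Measurable D := (measurable_lineDeriv hg.continuous).comp hev.measurable
  have hDb : ∀ γ, ‖D γ‖ ≤ L * ‖c‖ := fun γ => abs_lineDeriv_le hg _ c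
  have hprob : IsProbabilityMeasure (P.map BF) := Measure.isProbabilityMeasure_map hBF_meas
  have hGBF : AEStronglyMeasurable (fun ω => G (BF ω)) P :=
    (hGc.measurable.comp_aemeasurable hBF_meas).aestronglyMeasurable
  refine ⟨ψ, (hiff ψ).2 hψ, fun ψ' hψ' => hbij.injective (((hiff ψ').1 hψ').trans hψ.symm),
    Z, D, ?_, ⟨MemLp.of_bound hDm.aestronglyMeasurable _ (Eventually.of_forall hDb), ?_⟩,
    Integrable.of_bound (hDm.comp_aemeasurable hBF_meas).aestronglyMeasurable _
      (Eventually.of_forall fun ω => hDb _), ?_, ?_⟩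
  · rw [hZ, ← hψ]
    exact isFIntegral_of_isometry hW hT.le (fun t => IsWienerIntegral.ae_eq hW hWB t.2
      (hBFhat t) (hstep t t.2)) ψ
  · refine (tendsto_eLpNorm_quotient hY hZm hind hlaw hXY hg hcd).congr fun ε => ?_
    have hm : AEStronglyMeasurable (fun γ : PathSpace T => (G (γ + ε • k) - G γ) / ε - D γ)
        (P.map BF) := by
      have : Measurable fun γ : PathSpace T => G (γ + ε • k) :=
        (hGc.comp (continuous_id.add continuous_const)).measurable
      exact (((this.sub hGc.measurable).div_const ε).sub hDm).aestronglyMeasurable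
    rw [eLpNorm_map_measure hm hBF_meas]
    congr 1
    ext ω
    simp only [Function.comp_apply, hGg]
    rfl
  · exact ((Lp.memLp Z).integrable one_le_two).bdd_mul hGBF
      (Eventually.of_forall fun ω => by rw [hGg]; exact hC _)
  · simp only [hGg]
    exact integral_lineDeriv_eq hY hZm hind hlaw hXY hg hC hcd
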